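/- \textbf{Setting.} Let $A$ and $B$ be registers of $n\ge 0$ and $m\ge 0$ qubits. For a bit string $x$ write $|x|$ for its number of ones. Let $\Pi_a=\sum_{|x|=a}|x\rangle\langle x|$ on either register, let $\mathcal N_A,\mathcal N_B$ be the number operators ($\mathcal N|x\rangle=|x|\,|x\rangle$), and for an integer $-m\le i\le n$ let $$P_i=\sum_{0\le a\le n,\;0\le b\le m,\;a-b=i}\Pi_a\otimes\Pi_b ,$$ the projector onto the eigenspace of $\mathcal N_A-\mathcal N_B$ with eigenvalue $i$. Write $\rho^\Gamma$ for the partial transpose of $\rho$ with respect to $B$, $p_k(X)=\mathrm{tr}(X^k)$, and $$D_2^{(i)}(\rho)=p_1(P_i\rho^\Gamma P_i)^2-p_2(P_i\rho^\Gamma P_i).$$ On two copies of $AB$, let $W_A$ (resp. $W_B$) swap the two copies of $A$ (resp. $B$), and let $$Q=P_i\otimes P_i-\tfrac12 W_A(P_i\otimes \mathbb I)W_B-\tfrac12 W_B(P_i\otimes\mathbb I)W_A .$$ \textbf{Measurements.} Let $\rho_1,\dots,\rho_N$ ($N\ge 2$) be density matrices on $AB$, not necessarily identical, each commuting with $\mathcal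 N_A+\mathcal N_B$, and let $\rho_{\mathrm{avg}}=\frac1N\sum_{k}\rho_k$. In round $k$, independently of the other rounds, one draws single-qubit gates $U_1,\dots,U_{n+m}$ independently and uniformly from the single-qubit Clifford group (the finite group generated by the Hadamard and the phase gate), applies $U=U_1\otimes\cdots\otimes U_{n+m}$ to $\rho_k$, and measures in the computational basis, so that outcome $\hat b\in\{0,1\}^{n+m}$ has conditional probability $\langle \hat b|U\rho_kU^\dagger|\hat b\rangle$. The snapshot of the round is $$\hat\rho_k=\bigotimes_{l=1}^{n+m}\bigl(3\,U_l^\dagger|\hat b_l\rangle\langle\hat b_l|U_l-\mathbb I\bigr),$$ and the estimator is $$\widehat D^{(i)}_{2,(N)}=\frac1{N(N-1)}\sum_{j\ne k}\mathrm{tr}\bigl(Q\,\hat\rho_j\otimes\hat\rho_k\bigr).$$ \textbf{Statement.} Let $\delta\in(0,1)$ and put $$C_1=\max_{1\le k\le N}4\left(\mathrm{tr}(P_i\rho_k)^2+\frac{\mathrm{tr}(\rho_k^\Gamma P_i\rho_k^\Gamma)-2\,\mathrm{tr}(P_i\rho_k)^2}{\mathrm{tr}(P_i)}\right),\qquad C_2=1+\frac{3\,\mathrm{tr}(P_i)-4+8/(\mathrm{tr}(P_i)2^{2(n+m)})}{2^{n+m}},$$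 $$\epsilon=\sqrt{\frac{2^{n+m}\,\mathrm{tr}(P_i)}{\delta(N-1)}\left(C_1+C_2\frac{2^{2(n+m)}}{N-1}\right)} .$$ Then, with probability at least $1-\delta$, $$D_2^{(i)}(\rho_{\mathrm{avg}})\in\bigl[\widehat D^{(i)}_{2,(N)}-\epsilon,\ \widehat D^{(i)}_{2,(N)}+\epsilon\bigr].$$ -/

import Mathlib

open MeasureTheory ProbabilityTheory Matrix
open scoped Kronecker ComplexOrder

namespace SymShadow

noncomputable section

/-! Qubit registers, number operators and the sector projectors -/

/-- Computational basis labels (bit strings) of a register of `n` qubits. -/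
abbrev Bits (n : ℕ) : Type := Fin n → Fin 2

/-- Basis labels of the bipartite system `AB`, with `n` qubits in `A` and `m` qubits in `B`. -/
abbrev AB (n m : ℕ) : Type := Bits n × Bits m

/-- Operators on `AB`, as matrices in the computational basis. -/
abbrev Op (n m : ℕ) : Type := Matrix (AB n m) (AB n m) ℂ

/-- Operators on two copies of `AB`. -/
abbrev Op2 (n m : ℕ) : Type := Matrix (AB n m × AB n m) (AB n m × AB n m) ℂ

/-- The number of ones in a bit string. -/
def weight {n : ℕ} (x : Bits n) : ℕ := ∑ k, (x k : ℕ)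

/-- The number operator of a register of `n` qubits. -/
def numberOp (n : ℕ) : Matrix (Bits n) (Bits n) ℂ :=
  Matrix.diagonal fun x => (weight x : ℂ)

/-- The total number operator `N_A ⊗ 1 + 1 ⊗ N_B`. -/
def totalNumberOp (n m : ℕ) : Op n m :=
  numberOp n ⊗ₖ (1 : Matrix (Bits m) (Bits m) ℂ) +
    (1 : Matrix (Bits n) (Bits n) ℂ) ⊗ₖ numberOp m

/-- The projector onto the span of the basis states of `n` qubits that have exactly `a` ones. -/
def weightProj (n a : ℕ) : Matrix (Bits n) (Bits n) ℂ :=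
  Matrix.diagonal fun x => if weight x = a then 1 else 0

/-- The sector projector: the sum of `Π_a ⊗ Π_b` over all `a ≤ n`, `b ≤ m` with `a - b = i`. -/
def sectorProj (n m : ℕ) (i : ℤ) : Op n m :=
  ∑ p ∈ (Finset.range (n + 1) ×ˢ Finset.range (m + 1)).filter
      (fun p : ℕ × ℕ => (p.1 : ℤ) - (p.2 : ℤ) = i),
    weightProj n p.1 ⊗ₖ weightProj m p.2

/-- Density matrices: positive semidefinite (in particular Hermitian) with trace one. -/
def IsState {n m : ℕ} (ρ : Op n m) : Prop := ρ.PosSemidef ∧ ρ.trace = 1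

/-- The partial transpose with respect to the subsystem `B`. -/
def partialTranspose {n m : ℕ} (ρ : Op n m) : Op n m :=
  Matrix.of fun x y => ρ (x.1, y.2) (y.1, x.2)

/-- The `k`-th moment `tr (X ^ k)` of a Hermitian operator, as a real number. -/
def moment {n m : ℕ} (k : ℕ) (X : Op n m) : ℝ := ((X ^ k).trace).re

/-- The dimension `tr P_i` of the sector `i`. -/
def sectorDim (n m : ℕ) (i : ℤ) : ℝ := ((sectorProj n m i).trace).re

/-- `D_2^{(i)}(ρ) = p_1(P_i ρ^Γ P_i)^2 - p_2(P_i ρ^Γ P_i)`. -/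
def D2 {n m : ℕ} (i : ℤ) (ρ : Op n m) : ℝ :=
  moment 1 (sectorProj n m i * partialTranspose ρ * sectorProj n m i) ^ 2 -
    moment 2 (sectorProj n m i * partialTranspose ρ * sectorProj n m i)

/-! The two-copy observable -/

/-- The operator that swaps the two copies of `A`. -/
def swapA (n m : ℕ) : Op2 n m :=
  Matrix.of fun x y => if x = ((y.2.1, y.1.2), (y.1.1, y.2.2)) then 1 else 0

/-- The operator that swaps the two copies of `B`. -/
def swapB (n m : ℕ) : Op2 n m :=
  Matrix.of fun x y => if x = ((y.1.1, y.2.2), (y.2.1, y.1.2)) then 1 else 0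

/-- The symmetric two-copy observable `Q` with `tr (Q (ρ ⊗ ρ)) = D_2^{(i)}(ρ)` for symmetric `ρ`:
`Q = P ⊗ P - W_A (P ⊗ 1) W_B / 2 - W_B (P ⊗ 1) W_A / 2`. -/
def obsQ (n m : ℕ) (i : ℤ) : Op2 n m :=
  sectorProj n m i ⊗ₖ sectorProj n m i
    - (1 / 2 : ℂ) • (swapA n m * (sectorProj n m i ⊗ₖ (1 : Op n m)) * swapB n m)
    - (1 / 2 : ℂ) • (swapB n m * (sectorProj n m i ⊗ₖ (1 : Op n m)) * swapA n m)

/-! Randomized single-qubit Clifford measurements and classical shadows -/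

/-- The Hadamard gate. -/
def hadamard : Matrix.unitaryGroup (Fin 2) ℂ :=
  ⟨((Real.sqrt 2 : ℂ)⁻¹) • !![1, 1; 1, -1], by
    have h : ((Real.sqrt 2 : ℂ)) * (Real.sqrt 2 : ℂ) = 2 := by
      rw [← Complex.ofReal_mul, Real.mul_self_sqrt (by norm_num)]; norm_num
    have h' : ((Real.sqrt 2 : ℂ)⁻¹) * ((Real.sqrt 2 : ℂ)⁻¹) = 1 / 2 := by
      rw [← mul_inv, h]; norm_num
    rw [Matrix.mem_unitaryGroup_iff]
    ext i j
    fin_cases i <;> fin_cases j <;>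
      simp [Matrix.mul_apply, Fin.sum_univ_two, Matrix.star_apply, h'] <;> norm_num⟩

/-- The phase gate. -/
def phaseGate : Matrix.unitaryGroup (Fin 2) ℂ :=
  ⟨!![1, 0; 0, Complex.I], by
    rw [Matrix.mem_unitaryGroup_iff]
    ext i j
    fin_cases i <;> fin_cases j <;>
      simp [Matrix.mul_apply, Fin.sum_univ_two, Matrix.star_apply]⟩

/-- The single-qubit Clifford group: the (finite) group generated by the Hadamard and the
phase gate. -/
def clifford : Subgroup (Matrix.unitaryGroup (Fin 2) ℂ) :=
  Subgroup.closure {hadamard, phaseGate}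

/-- The discrete measurable structure on the single-qubit Clifford group. -/
instance : MeasurableSpace clifford := ⊤

/-- A choice of one single-qubit Clifford gate for each of the `n + m` qubits. -/
abbrev Setting (n m : ℕ) : Type := Fin n ⊕ Fin m → clifford

/-- A measurement outcome: one bit for each of the `n + m` qubits. -/
abbrev Outcome (n m : ℕ) : Type := Fin n ⊕ Fin m → Fin 2

/-- The tensor product of one `2 × 2` matrix per qubit of a register. -/
def tensor {n : ℕ} (X : Fin n → Matrix (Fin 2) (Fin 2) ℂ) : Matrix (Bits n) (Bits n) ℂ :=
  Matrix.of fun x y => ∏ k, X k (x k) (y k)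

/-- The tensor product of one `2 × 2` matrix per qubit of `AB`. -/
def tensorAB {n m : ℕ} (X : Fin n ⊕ Fin m → Matrix (Fin 2) (Fin 2) ℂ) : Op n m :=
  tensor (fun k => X (Sum.inl k)) ⊗ₖ tensor (fun k => X (Sum.inr k))

/-- The `2 × 2` matrix of a single-qubit Clifford gate. -/
def gate (u : clifford) : Matrix (Fin 2) (Fin 2) ℂ := (u : Matrix.unitaryGroup (Fin 2) ℂ)

/-- The basis state of `AB` that belongs to an outcome. -/
def label {n m : ℕ} (β : Outcome n m) : AB n m :=
  (fun k => β (Sum.inl k), fun k => β (Sum.inr k))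

/-- The Born probability `⟨β| U ρ U† |β⟩` of the outcome `β`, where `U` is the tensor product of
the gates `u`. -/
def bornProb {n m : ℕ} (ρ : Op n m) (u : Setting n m) (β : Outcome n m) : ℝ :=
  ((tensorAB (fun k => gate (u k)) * ρ * (tensorAB (fun k => gate (u k)))ᴴ)
    (label β) (label β)).re

/-- The classical snapshot: the tensor product over all qubits of `3 U_k† |β_k⟩⟨β_k| U_k - 1`. -/
def snapshot {n m : ℕ} (u : Setting n m) (β : Outcome n m) : Op n m :=
  tensorAB fun k =>
    (3 : ℂ) • ((gate (u k))ᴴ * Matrix.single (β k) (β k) 1 * gate (u k)) - 1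

/-- The data of `N` randomized single-qubit measurements, the `k`-th one on the state `ρ k`:
the pairs (setting, outcome) of the `N` rounds are independent, in each round the gates on the
`n + m` qubits are independent and uniformly distributed in the Clifford group, and given the
gates, the outcome follows the Born rule. -/
structure IsRandomizedMeasurement {n m N : ℕ} {Ω : Type*} [MeasurableSpace Ω] (μ : Measure Ω)
    (ρ : Fin N → Op n m) (U : Fin N → Ω → Setting n m) (b : Fin N → Ω → Outcome n m) : Prop where
  measurable_setting : ∀ k, Measurable (U k)
  measurable_outcome : ∀ k, Measurable (b k)
  indep : iIndepFun (fun k ω => (U k ω, b k ω)) μ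
  law : ∀ (k : Fin N) (u : Setting n m) (β : Outcome n m),
    μ.real {ω | U k ω = u ∧ b k ω = β} =
      ((Nat.card clifford : ℝ) ^ (n + m))⁻¹ * bornProb (ρ k) u β

/-- The U-statistics estimator: the average of `tr (Q (ρ̂_j ⊗ ρ̂_k))` over all ordered pairs of
distinct snapshots. -/
def estimator {n m N : ℕ} (i : ℤ) (u : Fin N → Setting n m) (β : Fin N → Outcome n m) : ℝ :=
  1 / ((N : ℝ) * ((N : ℝ) - 1)) *
    ∑ p ∈ (Finset.univ : Finset (Fin N × Fin N)).filter (fun p => p.1 ≠ p.2),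
      ((obsQ n m i * (snapshot (u p.1) (β p.1) ⊗ₖ snapshot (u p.2) (β p.2))).trace).re

/-! The average state and the two constants -/

/-- The average source state. -/
def avgState {n m N : ℕ} (ρ : Fin N → Op n m) : Op n m := (N : ℂ)⁻¹ • ∑ k, ρ k

/-- The constant `C_1`. -/
def C1 {n m N : ℕ} (i : ℤ) (ρ : Fin N → Op n m) : ℝ :=
  ⨆ k : Fin N, 4 * (((sectorProj n m i * ρ k).trace).re ^ 2 +
    (((partialTranspose (ρ k) * sectorProj n m i * partialTranspose (ρ k)).trace).re -
      2 * ((sectorProj n m i * ρ k).trace).re ^ 2) / sectorDim n m i)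

/-- The constant `C_2`. -/
def C2 (n m : ℕ) (i : ℤ) : ℝ :=
  1 + (3 * sectorDim n m i - 4 + 8 / (sectorDim n m i * 2 ^ (2 * (n + m)))) / 2 ^ (n + m)

/-- The half-width of the confidence interval. -/
def halfWidth {n m N : ℕ} (i : ℤ) (δ : ℝ) (ρ : Fin N → Op n m) : ℝ :=
  Real.sqrt (2 ^ (n + m) * sectorDim n m i / (δ * ((N : ℝ) - 1)) *
    (C1 i ρ + C2 n m i * (2 ^ (2 * (n + m)) / ((N : ℝ) - 1))))

end

end SymShadow

namespace SymShadow

noncomputable section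

/-! Write d = 2^(n+m) and D = tr P_i. The map (σ, τ) ↦ Re tr(Q (σ ⊗ τ)) is a symmetric real bilinear
form, `pairing`. A state that commutes with the total number operator has ρ x y = 0 unless x and y
carry the same total number of ones, and this makes D_2^{(i)}(ρ) equal to `pairing i ρ ρ`
(`D2_eq_pairing`). The theorem is Chebyshev's inequality for the mean squared error of a U-statistic
with this kernel.

Snapshots are unbiased (`sum_recordProb_smul_snapshot`), so the estimator has as mean the average of
`pairing i (ρ j) (ρ k)` over j ≠ k. For unequal states this differs from the value at the average
state, but by at most 2/(N-1) (`abs_mean_sub_pairing_avg_le`).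

For the variance, the Hoeffding decomposition (`estimator_sub_mean`) writes the centred estimator as
linear terms plus quadratic terms with vanishing conditional means. These are orthogonal, so only
their second moments remain (`expect_ustat_sq`). Each is bounded by the state-independent estimate
E|tr(O ρ̂)|² ≤ d ‖O‖² in Hilbert-Schmidt norm (`sum_recordProb_mul_norm_sq_le`) and its two-copy
version with d². For the linear terms O is Q contracted with a sum of N-1 states, whose norm `C1`
controls; for the quadratic terms O is Q itself, with ‖Q‖² = 3D²/2 - 2D + Dd/2.

The constants fit exactly: d³ D `C2` = 2 d² ‖Q‖² + 8, where the 8 leaves room for the squared bias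
4/(N-1)² (`error_budget_eq`). -/

/-! Finiteness of the single-qubit Clifford group -/

/-- The Pauli matrix `Z`. -/
def pauliZ : Matrix (Fin 2) (Fin 2) ℂ := !![1, 0; 0, -1]

/-- The Pauli matrix `X`. -/
def pauliX : Matrix (Fin 2) (Fin 2) ℂ := !![0, 1; 1, 0]

/-- The Pauli matrix `Y`. -/
def pauliY : Matrix (Fin 2) (Fin 2) ℂ := !![0, -Complex.I; Complex.I, 0]

/-- The signed Pauli matrices. -/
def signedPaulis : Set (Matrix (Fin 2) (Fin 2) ℂ) :=
  {pauliX, -pauliX, pauliY, -pauliY, pauliZ, -pauliZ}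

lemma inv_sqrt_two_mul_self : ((Real.sqrt 2 : ℂ)⁻¹) * ((Real.sqrt 2 : ℂ)⁻¹) = 1 / 2 := by
  rw [← mul_inv, ← Complex.ofReal_mul, Real.mul_self_sqrt (by norm_num)]; norm_num

lemma hadamard_conj (M : Matrix (Fin 2) (Fin 2) ℂ) :
    (hadamard : Matrix (Fin 2) (Fin 2) ℂ)ᴴ * M * (hadamard : Matrix (Fin 2) (Fin 2) ℂ) =
      (1 / 2 : ℂ) • !![M 0 0 + M 0 1 + M 1 0 + M 1 1, M 0 0 - M 0 1 + M 1 0 - M 1 1;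
        M 0 0 + M 0 1 - M 1 0 - M 1 1, M 0 0 - M 0 1 - M 1 0 + M 1 1] := by
  rw [← inv_sqrt_two_mul_self]
  ext i j
  fin_cases i <;> fin_cases j <;>
    simp [hadamard, Matrix.mul_apply, Fin.sum_univ_two] <;> ring

lemma phaseGate_conj (M : Matrix (Fin 2) (Fin 2) ℂ) :
    (phaseGate : Matrix (Fin 2) (Fin 2) ℂ)ᴴ * M * (phaseGate : Matrix (Fin 2) (Fin 2) ℂ) =
      !![M 0 0, Complex.I * M 0 1; -Complex.I * M 1 0, M 1 1] := by
  ext i j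
  fin_cases i <;> fin_cases j <;>
    simp [phaseGate, Matrix.mul_apply, Fin.sum_univ_two]
  · ring
  · linear_combination (-M 1 1) * Complex.I_mul_I

lemma hadamard_conj_mem {M : Matrix (Fin 2) (Fin 2) ℂ} (hM : M ∈ signedPaulis) :
    (hadamard : Matrix (Fin 2) (Fin 2) ℂ)ᴴ * M * (hadamard : Matrix (Fin 2) (Fin 2) ℂ) ∈
      signedPaulis := by
  rw [hadamard_conj]
  simp only [signedPaulis, Set.mem_insert_iff, Set.mem_singleton_iff] at hM ⊢
  rcases hM with rfl | rfl | rfl | rfl | rfl | rfl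
  · right; right; right; right; left
    ext i j; fin_cases i <;> fin_cases j <;> simp [pauliX, pauliZ] <;> norm_num
  · right; right; right; right; right
    ext i j; fin_cases i <;> fin_cases j <;> simp [pauliX, pauliZ] <;> norm_num
  · right; right; right; left
    ext i j; fin_cases i <;> fin_cases j <;> simp [pauliY] <;> ring
  · right; right; left
    ext i j; fin_cases i <;> fin_cases j <;> simp [pauliY] <;> ring
  · left
    ext i j; fin_cases i <;> fin_cases j <;> simp [pauliX, pauliZ] <;> norm_num
  · right; left
    ext i j; fin_cases i <;> fin_cases j <;> simp [pauliX, pauliZ] <;> norm_num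

lemma phaseGate_conj_mem {M : Matrix (Fin 2) (Fin 2) ℂ} (hM : M ∈ signedPaulis) :
    (phaseGate : Matrix (Fin 2) (Fin 2) ℂ)ᴴ * M * (phaseGate : Matrix (Fin 2) (Fin 2) ℂ) ∈
      signedPaulis := by
  rw [phaseGate_conj]
  simp only [signedPaulis, Set.mem_insert_iff, Set.mem_singleton_iff] at hM ⊢
  rcases hM with rfl | rfl | rfl | rfl | rfl | rfl
  · right; right; right; left
    ext i j; fin_cases i <;> fin_cases j <;> simp [pauliX, pauliY]
  · right; right; left
    ext i j; fin_cases i <;> fin_cases j <;> simp [pauliX, pauliY]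
  · left
    ext i j; fin_cases i <;> fin_cases j <;> simp [pauliX, pauliY]
  · right; left
    ext i j; fin_cases i <;> fin_cases j <;> simp [pauliX, pauliY]
  · right; right; right; right; left
    ext i j; fin_cases i <;> fin_cases j <;> simp [pauliZ]
  · right; right; right; right; right
    ext i j; fin_cases i <;> fin_cases j <;> simp [pauliZ]

lemma finite_signedPaulis : signedPaulis.Finite := by
  unfold signedPaulis; exact Set.toFinite _

/-- Clifford gates permute the signed Pauli matrices, and their determinants are fourth roots of
unity. -/
lemma conj_mem_of_mem_clifford {u : Matrix.unitaryGroup (Fin 2) ℂ} (hu : u ∈ clifford) :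
    (∀ M ∈ signedPaulis, (u : Matrix (Fin 2) (Fin 2) ℂ)ᴴ * M * u ∈ signedPaulis) ∧
      (u : Matrix (Fin 2) (Fin 2) ℂ).det ^ 4 = 1 := by
  -- Closure induction also needs inverses: an injective self-map of a finite set is onto, so the
  -- inverse conjugation preserves the set too.
  have key : ∀ v : Matrix.unitaryGroup (Fin 2) ℂ,
      (∀ M ∈ signedPaulis, (v : Matrix (Fin 2) (Fin 2) ℂ)ᴴ * M * v ∈ signedPaulis) →
      ∀ M ∈ signedPaulis, ((v⁻¹ : Matrix.unitaryGroup (Fin 2) ℂ) : Matrix (Fin 2) (Fin 2) ℂ)ᴴ *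
        M * (v⁻¹ : Matrix.unitaryGroup (Fin 2) ℂ) ∈ signedPaulis := by
    intro v hv
    have hvv : (v : Matrix (Fin 2) (Fin 2) ℂ) * (v : Matrix (Fin 2) (Fin 2) ℂ)ᴴ = 1 :=
      Matrix.mem_unitaryGroup_iff.mp v.2
    have hinj : Set.InjOn (fun M => (v : Matrix (Fin 2) (Fin 2) ℂ)ᴴ * M * v) signedPaulis := by
      intro M _ M' _ h
      have := congrArg (fun X => (v : Matrix (Fin 2) (Fin 2) ℂ) * X *
        (v : Matrix (Fin 2) (Fin 2) ℂ)ᴴ) h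
      simpa [Matrix.mul_assoc, hvv, ← Matrix.mul_assoc (v : Matrix (Fin 2) (Fin 2) ℂ)] using this
    intro M hM
    obtain ⟨M', hM', rfl⟩ := (finite_signedPaulis.injOn_iff_bijOn_of_mapsTo hv).mp hinj |>.surjOn hM
    simpa [Matrix.UnitaryGroup.inv_val, star_eq_conjTranspose, Matrix.mul_assoc, hvv,
      ← Matrix.mul_assoc (v : Matrix (Fin 2) (Fin 2) ℂ)] using hM'
  induction hu using Subgroup.closure_induction with
  | mem x hx =>
    rcases hx with rfl | rfl
    · refine ⟨fun M hM => hadamard_conj_mem hM, ?_⟩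
      simp only [hadamard, Matrix.det_smul, Matrix.det_fin_two_of]
      have := inv_sqrt_two_mul_self
      simp only [Fintype.card_fin, pow_two, this]; norm_num
    · refine ⟨fun M hM => phaseGate_conj_mem hM, ?_⟩
      simp [phaseGate, Matrix.det_fin_two_of, Complex.I_pow_four]
  | one => simp
  | mul x y _ _ hx hy =>
    refine ⟨fun M hM => ?_, by simp [mul_pow, hx.2, hy.2]⟩
    have := hy.1 _ (hx.1 M hM)
    simpa [Matrix.mul_assoc] using this
  | inv x _ hx =>
    refine ⟨key x hx.1, ?_⟩
    rw [Matrix.UnitaryGroup.inv_val, star_eq_conjTranspose, Matrix.det_conjTranspose, ← star_pow,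
      hx.2, star_one]

/-- The quotient c = u v† commutes with Z, hence is diagonal, and with X, hence is scalar; equal
determinants force its square to be 1. -/
lemma eq_or_eq_neg_of_conj_eq {u v : Matrix.unitaryGroup (Fin 2) ℂ}
    (hZ : (u : Matrix (Fin 2) (Fin 2) ℂ)ᴴ * pauliZ * u =
      (v : Matrix (Fin 2) (Fin 2) ℂ)ᴴ * pauliZ * v)
    (hX : (u : Matrix (Fin 2) (Fin 2) ℂ)ᴴ * pauliX * u =
      (v : Matrix (Fin 2) (Fin 2) ℂ)ᴴ * pauliX * v)
    (hd : (u : Matrix (Fin 2) (Fin 2) ℂ).det = (v : Matrix (Fin 2) (Fin 2) ℂ).det) :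
    (u : Matrix (Fin 2) (Fin 2) ℂ) = v ∨ (u : Matrix (Fin 2) (Fin 2) ℂ) = -v := by
  have huu : (u : Matrix (Fin 2) (Fin 2) ℂ) * (u : Matrix (Fin 2) (Fin 2) ℂ)ᴴ = 1 :=
    Matrix.mem_unitaryGroup_iff.mp u.2
  have hvv : (v : Matrix (Fin 2) (Fin 2) ℂ) * (v : Matrix (Fin 2) (Fin 2) ℂ)ᴴ = 1 :=
    Matrix.mem_unitaryGroup_iff.mp v.2
  have hvv' : (v : Matrix (Fin 2) (Fin 2) ℂ)ᴴ * (v : Matrix (Fin 2) (Fin 2) ℂ) = 1 :=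
    Matrix.mem_unitaryGroup_iff'.mp v.2
  set c : Matrix (Fin 2) (Fin 2) ℂ :=
    (u : Matrix (Fin 2) (Fin 2) ℂ) * (v : Matrix (Fin 2) (Fin 2) ℂ)ᴴ with hc
  have hu : (u : Matrix (Fin 2) (Fin 2) ℂ) = c * v := by
    rw [hc, Matrix.mul_assoc, hvv', Matrix.mul_one]
  have comm : ∀ M : Matrix (Fin 2) (Fin 2) ℂ,
      (u : Matrix (Fin 2) (Fin 2) ℂ)ᴴ * M * u = (v : Matrix (Fin 2) (Fin 2) ℂ)ᴴ * M * v →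
      M * c = c * M := by
    intro M h
    have := congrArg (fun X => (u : Matrix (Fin 2) (Fin 2) ℂ) * X *
      (v : Matrix (Fin 2) (Fin 2) ℂ)ᴴ) h
    simp only [← Matrix.mul_assoc, huu, Matrix.one_mul] at this
    simp only [Matrix.mul_assoc, hvv, Matrix.mul_one] at this
    rw [this, hc, Matrix.mul_assoc]
  have h1 := comm _ hZ
  have h2 := comm _ hX
  have h01 : c 0 1 = 0 := by
    have := congrFun (congrFun h1 0) 1
    simp [pauliZ, Matrix.mul_apply, Fin.sum_univ_two] at this
    linear_combination this / 2
  have h10 : c 1 0 = 0 := by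
    have := congrFun (congrFun h1 1) 0
    simp [pauliZ, Matrix.mul_apply, Fin.sum_univ_two] at this
    linear_combination -this / 2
  have h11 : c 1 1 = c 0 0 := by
    have := congrFun (congrFun h2 0) 1
    simpa [pauliX, Matrix.mul_apply, Fin.sum_univ_two] using this
  have hdc : c.det = 1 := by
    have h3 : c.det * (v : Matrix (Fin 2) (Fin 2) ℂ).det = (v : Matrix (Fin 2) (Fin 2) ℂ).det := by
      rw [← Matrix.det_mul, ← hu, hd]
    have h4 : (v : Matrix (Fin 2) (Fin 2) ℂ).det ≠ 0 := by
      intro h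
      have := congrArg Matrix.det hvv
      simp [h] at this
    exact mul_right_cancel₀ h4 (by rw [h3, one_mul])
  rw [Matrix.det_fin_two, h01, h11, zero_mul, sub_zero, mul_self_eq_one_iff] at hdc
  rcases hdc with h | h
  · left
    have : c = 1 := by ext i j; fin_cases i <;> fin_cases j <;> simp [h01, h10, h11, h]
    rw [hu, this, one_mul]
  · right
    have : c = -1 := by ext i j; fin_cases i <;> fin_cases j <;> simp [h01, h10, h11, h]
    rw [hu, this, neg_one_mul]

/-- A gate is determined up to sign by its action on Z and X and its determinant, and these data
range over a finite set. Finiteness gives content to `Nat.card clifford` in the law of the records,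
since the cardinality of an infinite type is 0 by convention. -/
instance finite_clifford : Finite clifford := by
  let f : clifford → Matrix (Fin 2) (Fin 2) ℂ × Matrix (Fin 2) (Fin 2) ℂ × ℂ := fun u =>
    ((gate u)ᴴ * pauliZ * gate u, (gate u)ᴴ * pauliX * gate u, (gate u).det)
  have hroots : {z : ℂ | z ^ 4 = 1}.Finite := by
    refine Set.Finite.subset (Polynomial.nthRoots 4 (1 : ℂ)).toFinset.finite_toSet fun z hz => ?_
    simpa [Polynomial.mem_nthRoots] using hz
  have hrange : (Set.range f).Finite := by
    refine Set.Finite.subset (finite_signedPaulis.prod (finite_signedPaulis.prod hroots)) ?_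
    rintro _ ⟨u, rfl⟩
    have := conj_mem_of_mem_clifford u.2
    exact ⟨this.1 _ (by simp [signedPaulis]), this.1 _ (by simp [signedPaulis]), this.2⟩
  rw [← Set.finite_univ_iff]
  refine Set.Finite.of_finite_fibers f (by simpa using hrange) ?_
  rintro _ ⟨v, -, rfl⟩
  have hg : Function.Injective gate := fun a b h => Subtype.ext (Subtype.ext h)
  refine Set.Finite.of_finite_image (f := gate)
    (Set.Finite.subset (Set.toFinite {gate v, -gate v}) ?_) hg.injOn
  rintro _ ⟨u, ⟨-, hu⟩, rfl⟩
  simp only [Set.mem_preimage, Set.mem_singleton_iff, f, Prod.mk.injEq] at hu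
  exact eq_or_eq_neg_of_conj_eq hu.1 hu.2.1 hu.2.2

instance : Fintype clifford := Fintype.ofFinite _

/-! Averages over the single-qubit Clifford group -/

/-- The observable `u† Z u` that is measured after applying the gate `u`. -/
def measuredPauli (u : clifford) : Matrix (Fin 2) (Fin 2) ℂ := (gate u)ᴴ * pauliZ * gate u

lemma measuredPauli_mul (u v : clifford) :
    measuredPauli (u * v) = (gate v)ᴴ * measuredPauli u * gate v := by
  simp [measuredPauli, gate, Matrix.mul_assoc]

lemma gate_mul_conjTranspose (u : clifford) : gate u * (gate u)ᴴ = 1 :=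
  Matrix.mem_unitaryGroup_iff.mp u.1.2

lemma gate_conjTranspose_mul (u : clifford) : (gate u)ᴴ * gate u = 1 :=
  Matrix.mem_unitaryGroup_iff'.mp u.1.2

lemma measuredPauli_star (u : clifford) (a b : Fin 2) :
    star (measuredPauli u a b) = measuredPauli u b a := by
  have h : (measuredPauli u)ᴴ = measuredPauli u := by
    have hZ : pauliZᴴ = pauliZ := by
      ext i j; fin_cases i <;> fin_cases j <;> simp [pauliZ]
    simp [measuredPauli, Matrix.conjTranspose_mul, hZ, Matrix.mul_assoc]
  exact congrFun (congrFun h b) a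

lemma measuredPauli_one_one (u : clifford) : measuredPauli u 1 1 = -measuredPauli u 0 0 := by
  have h : (measuredPauli u).trace = 0 := by
    rw [measuredPauli, Matrix.trace_mul_cycle, gate_mul_conjTranspose]
    simp [pauliZ, Matrix.trace_fin_two]
  rw [Matrix.trace_fin_two] at h
  linear_combination h

lemma measuredPauli_sq (u : clifford) :
    measuredPauli u 0 0 * measuredPauli u 0 0 + measuredPauli u 0 1 * measuredPauli u 1 0 = 1 := by
  have h : measuredPauli u * measuredPauli u = 1 := by
    have hZ : pauliZ * pauliZ = 1 := by
      ext i j; fin_cases i <;> fin_cases j <;> simp [pauliZ]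
    calc measuredPauli u * measuredPauli u
        = (gate u)ᴴ * (pauliZ * (gate u * (gate u)ᴴ) * pauliZ) * gate u := by
          simp only [measuredPauli, Matrix.mul_assoc]
      _ = 1 := by
          rw [gate_mul_conjTranspose, Matrix.mul_one, hZ, Matrix.mul_one, gate_conjTranspose_mul]
  have := congrFun (congrFun h 0) 0
  simpa [Matrix.mul_apply, Fin.sum_univ_two] using this

/-- The group is never enumerated: only invariance under right multiplication by the two generators
is used. The phase gate multiplies the off-diagonal entry w of u† Z u by i, which kills the sums of
zw and of w². The Hadamard gate turns the diagonal entry z into (w + w̄)/2, so the sum of z² is half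
the sum of |w|²; with z² + |w|² = 1 this gives the shares 1/3 and 2/3. -/
lemma sum_measuredPauli_mul_star (a b c d : Fin 2) :
    ∑ u : clifford, measuredPauli u a b * star (measuredPauli u c d) =
      (Nat.card clifford : ℂ) / 3 *
        (2 * (if a = c ∧ b = d then 1 else 0) - if a = b ∧ c = d then 1 else 0) := by
  let vH : clifford := ⟨hadamard, Subgroup.subset_closure (by simp)⟩
  let vS : clifford := ⟨phaseGate, Subgroup.subset_closure (by simp)⟩
  have inv : ∀ (v : clifford) (f : Matrix (Fin 2) (Fin 2) ℂ → ℂ),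
      ∑ u, f ((gate v)ᴴ * measuredPauli u * gate v) = ∑ u, f (measuredPauli u) := fun v f => by
    simp only [← measuredPauli_mul]
    exact Equiv.sum_comp (Equiv.mulRight v) fun u => f (measuredPauli u)
  have invH := inv vH
  have invS := inv vS
  have gH : gate vH = (hadamard : Matrix (Fin 2) (Fin 2) ℂ) := rfl
  have gS : gate vS = (phaseGate : Matrix (Fin 2) (Fin 2) ℂ) := rfl
  simp only [gH, hadamard_conj] at invH
  simp only [gS, phaseGate_conj] at invS
  have z01 : ∑ u, measuredPauli u 0 0 * measuredPauli u 0 1 = 0 := by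
    have := invS fun M => M 0 0 * M 0 1
    simp only [Matrix.of_apply, Matrix.cons_val_zero, Matrix.cons_val_one, Matrix.cons_val',
      mul_left_comm _ Complex.I, ← Finset.mul_sum] at this
    have hI : Complex.I - 1 ≠ 0 := fun h => by
      have := congrArg Complex.re h
      simp at this
    exact (mul_eq_zero.mp (show (Complex.I - 1) * _ = 0 by
      rw [sub_one_mul, this, sub_self])).resolve_left hI
  have z10 : ∑ u, measuredPauli u 0 0 * measuredPauli u 1 0 = 0 := by
    have := congrArg star z01
    simpa [star_sum, measuredPauli_star, ← Complex.star_def] using this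
  have w01 : ∑ u, measuredPauli u 0 1 * measuredPauli u 0 1 = 0 := by
    have := invS fun M => M 0 1 * M 0 1
    simp [mul_mul_mul_comm Complex.I _ Complex.I] at this
    linear_combination -this / 2
  have w10 : ∑ u, measuredPauli u 1 0 * measuredPauli u 1 0 = 0 := by
    have := congrArg star w01
    simpa [star_sum, measuredPauli_star, ← Complex.star_def] using this
  have zw : 2 * ∑ u, measuredPauli u 0 0 * measuredPauli u 0 0 =
      ∑ u, measuredPauli u 0 1 * measuredPauli u 1 0 := by
    have h := invH fun M => M 0 0 * M 0 0
    have h' : ∀ u, ((1 / 2 : ℂ) • !![measuredPauli u 0 0 + measuredPauli u 0 1 + measuredPauli u 1 0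
        + measuredPauli u 1 1, measuredPauli u 0 0 - measuredPauli u 0 1 + measuredPauli u 1 0 -
        measuredPauli u 1 1; measuredPauli u 0 0 + measuredPauli u 0 1 - measuredPauli u 1 0 -
        measuredPauli u 1 1, measuredPauli u 0 0 - measuredPauli u 0 1 - measuredPauli u 1 0 +
        measuredPauli u 1 1]) 0 0 = (measuredPauli u 0 1 + measuredPauli u 1 0) / 2 := fun u => by
      simp [measuredPauli_one_one]; ring
    simp only [h'] at h
    have e : ∀ u, (measuredPauli u 0 1 + measuredPauli u 1 0) / 2 *
        ((measuredPauli u 0 1 + measuredPauli u 1 0) / 2) =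
        1 / 4 * (measuredPauli u 0 1 * measuredPauli u 0 1) +
        1 / 2 * (measuredPauli u 0 1 * measuredPauli u 1 0) +
        1 / 4 * (measuredPauli u 1 0 * measuredPauli u 1 0) := fun u => by ring
    simp only [e, Finset.sum_add_distrib, ← Finset.mul_sum, w01, w10] at h
    linear_combination -2 * h
  have tot : ∑ u, measuredPauli u 0 0 * measuredPauli u 0 0 +
      ∑ u, measuredPauli u 0 1 * measuredPauli u 1 0 = Nat.card clifford := by
    rw [← Finset.sum_add_distrib]
    simp [measuredPauli_sq]
  have z00 : ∑ u, measuredPauli u 0 0 * measuredPauli u 0 0 = (Nat.card clifford : ℂ) / 3 := by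
    linear_combination (tot + zw) / 3
  have w0110 : ∑ u, measuredPauli u 0 1 * measuredPauli u 1 0 = 2 * (Nat.card clifford : ℂ) / 3 := by
    linear_combination (2 * tot - zw) / 3
  simp only [measuredPauli_star]
  fin_cases a <;> fin_cases b <;> fin_cases c <;> fin_cases d <;>
    simp [measuredPauli_one_one, mul_comm (measuredPauli _ 0 1) (measuredPauli _ 0 0),
      mul_comm (measuredPauli _ 1 0) (measuredPauli _ 0 0),
      mul_comm (measuredPauli _ 1 0) (measuredPauli _ 0 1), z00, z01, z10, w01, w10, w0110] <;> ring

/-- The sign `(-1) ^ β` of a measurement outcome. -/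
def outcomeSign (β : Fin 2) : ℂ := if β = 0 then 1 else -1

lemma conj_single_apply (u : clifford) (β : Fin 2) (a b : Fin 2) :
    ((gate u)ᴴ * (Matrix.single β β 1 : Matrix (Fin 2) (Fin 2) ℂ) * gate u) a b =
      star (gate u β a) * gate u β b := by
  fin_cases β <;> simp [Matrix.mul_apply, Fin.sum_univ_two, Matrix.single_apply]

/-- The projector |β⟩⟨β| is (1 ± Z)/2, with the sign given by the outcome. All dependence on the
gate thus passes through `measuredPauli`. -/
lemma conj_single_eq (u : clifford) (β : Fin 2) (a b : Fin 2) :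
    star (gate u β a) * gate u β b =
      1 / 2 * ((if a = b then 1 else 0) + outcomeSign β * measuredPauli u a b) := by
  have h1 : ((gate u)ᴴ * gate u) a b = if a = b then 1 else 0 := by
    rw [gate_conjTranspose_mul, Matrix.one_apply]
  have h2 : measuredPauli u a b =
      star (gate u 0 a) * gate u 0 b - star (gate u 1 a) * gate u 1 b := by
    simp [measuredPauli, pauliZ, Matrix.mul_apply, Fin.sum_univ_two]; ring
  have h3 : ((gate u)ᴴ * gate u) a b =
      star (gate u 0 a) * gate u 0 b + star (gate u 1 a) * gate u 1 b := by
    simp [Matrix.mul_apply, Fin.sum_univ_two]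
  rw [← h1, h2, h3]
  fin_cases β
  · simp [outcomeSign]; ring
  · simp [outcomeSign]; ring

/-- The snapshot of a single qubit. -/
def qubitSnapshot (u : clifford) (β : Fin 2) : Matrix (Fin 2) (Fin 2) ℂ :=
  (3 : ℂ) • ((gate u)ᴴ * Matrix.single β β 1 * gate u) - 1

lemma qubitSnapshot_apply (u : clifford) (β : Fin 2) (a b : Fin 2) :
    qubitSnapshot u β a b =
      1 / 2 * ((if a = b then 1 else 0) + 3 * outcomeSign β * measuredPauli u a b) := by
  rw [qubitSnapshot, Matrix.sub_apply, Matrix.smul_apply, conj_single_apply, conj_single_eq,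
    Matrix.one_apply, smul_eq_mul]
  ring

/-- The measure-and-prepare map of the snapshot of one qubit averages to the identity. -/
lemma sum_born_mul_qubitSnapshot (x y a b : Fin 2) :
    ∑ p : clifford × Fin 2, gate p.1 p.2 x * star (gate p.1 p.2 y) * qubitSnapshot p.1 p.2 a b =
      Nat.card clifford * if x = a ∧ y = b then 1 else 0 := by
  rw [Fintype.sum_prod_type]
  have h : ∀ u : clifford, ∑ β, gate u β x * star (gate u β y) * qubitSnapshot u β a b =
      1 / 2 * ((if y = x then 1 else 0) * (if a = b then 1 else 0)) +
        3 / 2 * (measuredPauli u a b * star (measuredPauli u x y)) := fun u => by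
    rw [measuredPauli_star]
    simp only [mul_comm (gate u _ x), conj_single_eq, qubitSnapshot_apply, Fin.sum_univ_two]
    simp only [outcomeSign, if_true, show ((1 : Fin 2) = 0) = False by simp, if_false]
    ring
  simp only [h, Finset.sum_add_distrib, ← Finset.mul_sum, sum_measuredPauli_mul_star,
    Finset.sum_const, Finset.card_univ, ← Nat.card_eq_fintype_card]
  fin_cases x <;> fin_cases y <;> fin_cases a <;> fin_cases b <;> simp <;> ring

/-- Up to sign, u† Z u is each of X, Y, Z with probability 1/3. The weight 3 compensates, so the sum
runs over all four Paulis with equal weight, and completeness of the Pauli basis gives the factor 2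
on one qubit. -/
lemma sum_one_add_measuredPauli (a b c d : Fin 2) :
    ∑ u : clifford, ((if a = b then 1 else 0) * (if c = d then 1 else 0) +
      3 * (measuredPauli u a b * star (measuredPauli u c d))) =
      Nat.card clifford * (2 * if a = c ∧ b = d then 1 else 0) := by
  simp only [Finset.sum_add_distrib, ← Finset.mul_sum, sum_measuredPauli_mul_star,
    Finset.sum_const, Finset.card_univ, ← Nat.card_eq_fintype_card]
  fin_cases a <;> fin_cases b <;> fin_cases c <;> fin_cases d <;> simp <;> ring

/-! Mean and second moment of the snapshot of a state -/

/-- Outcomes are the same as basis labels. -/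
def labelEquiv (n m : ℕ) : Outcome n m ≃ AB n m := Equiv.sumArrowEquivProdArrow _ _ _

lemma sum_label {n m : ℕ} {M : Type*} [AddCommMonoid M] (f : AB n m → M) :
    ∑ a : Outcome n m, f (label a) = ∑ x, f x :=
  Equiv.sum_comp (labelEquiv n m) f

lemma tensorAB_label {n m : ℕ} (X : Fin n ⊕ Fin m → Matrix (Fin 2) (Fin 2) ℂ) (a b : Outcome n m) :
    tensorAB X (label a) (label b) = ∏ k, X k (a k) (b k) := by
  simp [tensorAB, tensor, label, Matrix.kroneckerMap_apply, Fintype.prod_sum_type]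

lemma trace_mul_eq_sum_label {n m : ℕ} (O σ : Op n m) :
    (O * σ).trace = ∑ a : Outcome n m, ∑ b : Outcome n m,
      O (label a) (label b) * σ (label b) (label a) := by
  simp only [Matrix.trace, Matrix.diag_apply, Matrix.mul_apply]
  rw [← sum_label]
  exact Finset.sum_congr rfl fun a _ => (sum_label _).symm

/-- A sum over all settings and outcomes of a product over the qubits factorizes. -/
lemma sum_prod_qubits {ι α γ R : Type*} [Fintype ι] [DecidableEq ι] [Fintype α] [Fintype γ]
    [CommSemiring R] (f : ι → α → γ → R) :
    ∑ u : ι → α, ∑ β : ι → γ, ∏ k, f k (u k) (β k) = ∏ k, ∑ a, ∑ c, f k a c := by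
  simp only [Fintype.prod_sum]

lemma sum_comm_pairs {α β γ δ M : Type*} [Fintype α] [Fintype β] [Fintype γ] [Fintype δ]
    [AddCommMonoid M] (f : α → β → γ → δ → M) :
    ∑ a, ∑ b, ∑ c, ∑ d, f a b c d = ∑ c, ∑ d, ∑ a, ∑ b, f a b c d := by
  rw [Finset.sum_congr rfl fun a _ => Finset.sum_comm, Finset.sum_comm]
  refine Finset.sum_congr rfl fun c _ => ?_
  rw [Finset.sum_congr rfl fun a _ => Finset.sum_comm, Finset.sum_comm]

lemma prod_ite_eq_and {ι α : Type*} [Fintype ι] [DecidableEq α] (a b c d : ι → α) :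
    (∏ k, if a k = c k ∧ b k = d k then (1 : ℂ) else 0) = if a = c ∧ b = d then 1 else 0 := by
  classical
  rw [Finset.prod_ite_zero]
  simp [funext_iff, forall_and]

lemma born_eq {n m : ℕ} (ρ : Op n m) (u : Setting n m) (β : Outcome n m) :
    (tensorAB (fun k => gate (u k)) * ρ * (tensorAB (fun k => gate (u k)))ᴴ) (label β) (label β) =
      ∑ x : Outcome n m, ∑ y : Outcome n m, ρ (label x) (label y) *
        ∏ k, (gate (u k) (β k) (x k) * star (gate (u k) (β k) (y k))) := by
  rw [Matrix.mul_apply, ← sum_label, Finset.sum_comm]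
  refine Finset.sum_congr rfl fun y _ => ?_
  rw [Matrix.mul_apply, ← sum_label, Finset.sum_mul]
  refine Finset.sum_congr rfl fun x _ => ?_
  rw [Matrix.conjTranspose_apply, tensorAB_label, tensorAB_label, star_prod,
    Finset.prod_mul_distrib]
  ring

lemma born_nonneg {n m : ℕ} {ρ : Op n m} (hρ : IsState ρ) (u : Setting n m) (β : Outcome n m) :
    0 ≤ (tensorAB (fun k => gate (u k)) * ρ * (tensorAB (fun k => gate (u k)))ᴴ)
      (label β) (label β) :=
  (hρ.1.mul_mul_conjTranspose_same _).diag_nonneg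

lemma bornProb_nonneg {n m : ℕ} {ρ : Op n m} (hρ : IsState ρ) (u : Setting n m) (β : Outcome n m) :
    0 ≤ bornProb ρ u β :=
  (Complex.nonneg_iff.mp (born_nonneg hρ u β)).1

lemma coe_bornProb {n m : ℕ} {ρ : Op n m} (hρ : IsState ρ) (u : Setting n m) (β : Outcome n m) :
    (bornProb ρ u β : ℂ) = ∑ x : Outcome n m, ∑ y : Outcome n m, ρ (label x) (label y) *
        ∏ k, (gate (u k) (β k) (x k) * star (gate (u k) (β k) (y k))) := by
  rw [← born_eq]
  -- `bornProb` is defined as a real part; nonnegativity of the complex entry shows that nothing is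
  -- lost.
  exact (Complex.eq_re_of_ofReal_le (r := 0) (by simpa using born_nonneg hρ u β)).symm

lemma sum_bornProb {n m : ℕ} {ρ : Op n m} (hρ : IsState ρ) (u : Setting n m) :
    ∑ β, bornProb ρ u β = 1 := by
  have h : (∑ β, (bornProb ρ u β : ℂ)) = 1 := by
    simp only [coe_bornProb hρ]
    rw [Finset.sum_comm]
    simp only [Finset.sum_comm (s := (Finset.univ : Finset (Outcome n m))) (t := Finset.univ)
      (f := fun β y => ρ _ (label y) * _)]
    have hg : ∀ x y : Outcome n m, ∑ β : Outcome n m,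
        ∏ k, (gate (u k) (β k) (x k) * star (gate (u k) (β k) (y k))) =
          if y = x then 1 else 0 := fun x y => by
      rw [← Fintype.prod_sum fun k c => gate (u k) c (x k) * star (gate (u k) c (y k))]
      have : ∀ k, ∑ c, gate (u k) c (x k) * star (gate (u k) c (y k)) =
          if y k = x k then 1 else 0 := fun k => by
        rw [← Matrix.one_apply, ← gate_conjTranspose_mul (u k), Matrix.mul_apply]
        exact Finset.sum_congr rfl fun c _ => by rw [Matrix.conjTranspose_apply, mul_comm]
      simp only [this]
      rw [Finset.prod_ite_zero]
      simp [funext_iff]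
    simp only [← Finset.mul_sum, hg]
    simp only [mul_ite, mul_one, mul_zero, Finset.sum_ite_eq', Finset.mem_univ, if_true]
    rw [sum_label fun x => ρ x x]
    exact hρ.2
  exact_mod_cast h

/-- The probability of a record (setting, outcome) of one round. -/
def recordProb {n m : ℕ} (ρ : Op n m) (s : Setting n m × Outcome n m) : ℝ :=
  ((Nat.card clifford : ℝ) ^ (n + m))⁻¹ * bornProb ρ s.1 s.2

lemma card_clifford_pos : (0 : ℝ) < Nat.card clifford := by
  exact_mod_cast Nat.card_pos

lemma recordProb_nonneg {n m : ℕ} {ρ : Op n m} (hρ : IsState ρ) (s : Setting n m × Outcome n m) :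
    0 ≤ recordProb ρ s :=
  mul_nonneg (by positivity) (bornProb_nonneg hρ _ _)

lemma prod_const_qubits {n m : ℕ} {R : Type*} [CommMonoid R] (c : R) :
    ∏ _k : Fin n ⊕ Fin m, c = c ^ (n + m) := by
  simp

lemma sum_recordProb {n m : ℕ} {ρ : Op n m} (hρ : IsState ρ) :
    ∑ s, recordProb ρ s = 1 := by
  have := (pow_pos card_clifford_pos (n + m)).ne'
  simp only [recordProb, ← Finset.mul_sum, Fintype.sum_prod_type, sum_bornProb hρ]
  simp only [Finset.sum_const, Finset.card_univ, Fintype.card_fun, Fintype.card_sum, Fintype.card_fin,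
    ← Nat.card_eq_fintype_card (α := clifford), nsmul_eq_mul, mul_one, Nat.cast_pow]
  exact inv_mul_cancel₀ this

lemma snapshot_label {n m : ℕ} (u : Setting n m) (β : Outcome n m) (a b : Outcome n m) :
    snapshot u β (label a) (label b) = ∏ k, qubitSnapshot (u k) (β k) (a k) (b k) :=
  tensorAB_label _ _ _

/-- The snapshot is an unbiased estimator of the state. -/
lemma sum_recordProb_smul_snapshot {n m : ℕ} {ρ : Op n m} (hρ : IsState ρ) :
    ∑ s, recordProb ρ s • snapshot s.1 s.2 = ρ := by
  have hc : (Nat.card clifford : ℂ) ^ (n + m) ≠ 0 := by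
    have := (pow_pos card_clifford_pos (n + m)).ne'
    exact_mod_cast this
  have key : ∀ a b : Outcome n m, (∑ s : Setting n m × Outcome n m, recordProb ρ s • snapshot s.1 s.2)
      (label a) (label b) = ρ (label a) (label b) := by
    intro a b
    -- Everything factorizes over the qubits, and on each qubit the measure-and-prepare map averages
    -- to the identity.
    have h1 : ∀ x y : Outcome n m, ∑ u : Setting n m, ∑ β : Outcome n m,
        ∏ k, (gate (u k) (β k) (x k) * star (gate (u k) (β k) (y k)) *
          qubitSnapshot (u k) (β k) (a k) (b k)) =
        (Nat.card clifford : ℂ) ^ (n + m) * if x = a ∧ y = b then 1 else 0 := by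
      intro x y
      rw [sum_prod_qubits fun k (g : clifford) (c : Fin 2) =>
        gate g c (x k) * star (gate g c (y k)) * qubitSnapshot g c (a k) (b k)]
      simp only [← Fintype.sum_prod_type', sum_born_mul_qubitSnapshot]
      rw [Finset.prod_mul_distrib, prod_const_qubits, prod_ite_eq_and]
    rw [Matrix.sum_apply, Fintype.sum_prod_type]
    calc ∑ u : Setting n m, ∑ β : Outcome n m,
          (recordProb ρ (u, β) • snapshot u β) (label a) (label b)
        = ∑ u : Setting n m, ∑ β : Outcome n m, ∑ x : Outcome n m, ∑ y : Outcome n m,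
          ((Nat.card clifford : ℂ) ^ (n + m))⁻¹ * ρ (label x) (label y) *
          ∏ k, (gate (u k) (β k) (x k) * star (gate (u k) (β k) (y k)) *
          qubitSnapshot (u k) (β k) (a k) (b k)) := by
          refine Finset.sum_congr rfl fun u _ => Finset.sum_congr rfl fun β _ => ?_
          rw [Matrix.smul_apply, snapshot_label, recordProb, Complex.real_smul, Complex.ofReal_mul,
            coe_bornProb hρ, Finset.mul_sum, Finset.sum_mul]
          refine Finset.sum_congr rfl fun x _ => ?_
          rw [Finset.mul_sum, Finset.sum_mul]
          refine Finset.sum_congr rfl fun y _ => ?_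
          rw [Finset.prod_mul_distrib
            (f := fun k => gate (u k) (β k) (x k) * star (gate (u k) (β k) (y k)))]
          push_cast
          ring
      _ = ∑ x : Outcome n m, ∑ y : Outcome n m, ((Nat.card clifford : ℂ) ^ (n + m))⁻¹ *
          ρ (label x) (label y) * ∑ u : Setting n m, ∑ β : Outcome n m,
          ∏ k, (gate (u k) (β k) (x k) * star (gate (u k) (β k) (y k)) *
          qubitSnapshot (u k) (β k) (a k) (b k)) := by
          simp only [Finset.mul_sum]
          exact sum_comm_pairs _
      _ = ρ (label a) (label b) := by
          simp only [h1, ite_and, mul_ite, mul_one, mul_zero, Finset.sum_ite_eq', Finset.mem_univ,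
            if_true, Finset.sum_ite_irrel, Finset.sum_const_zero]
          field_simp
  ext x y
  rw [← (labelEquiv n m).apply_symm_apply x, ← (labelEquiv n m).apply_symm_apply y]
  exact key _ _

/-! ### Pauli expansion of a snapshot and the second moment bound -/

/-- The powers `1` and `u† Z u` that occur in the Pauli expansion of a snapshot. -/
def pauliPower (u : clifford) (e : Fin 2) : Matrix (Fin 2) (Fin 2) ℂ :=
  if e = 0 then 1 else measuredPauli u

/-- The weight `3 ^ |e|` of a Pauli string with support `e`. -/
def supportWeight {ι : Type*} [Fintype ι] (e : ι → Fin 2) : ℝ := ∏ k, if e k = 0 then 1 else 3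

lemma supportWeight_nonneg {ι : Type*} [Fintype ι] (e : ι → Fin 2) : 0 ≤ supportWeight e :=
  Finset.prod_nonneg fun k _ => by split_ifs <;> norm_num

lemma sum_supportWeight (n m : ℕ) : ∑ e : Fin n ⊕ Fin m → Fin 2, supportWeight e = 4 ^ (n + m) := by
  simp only [supportWeight]
  rw [← Fintype.prod_sum fun _ (c : Fin 2) => (if c = 0 then 1 else 3 : ℝ)]
  simp only [Fin.sum_univ_two, if_true, one_ne_zero, if_false]
  rw [prod_const_qubits]
  norm_num

/-- The coefficient of an operator along the Pauli string `⊗ (u† Z u) ^ e`. -/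
def pauliCoeff {n m : ℕ} (O : Op n m) (u : Setting n m) (e : Outcome n m) : ℂ :=
  ∑ a : Outcome n m, ∑ b : Outcome n m,
    O (label a) (label b) * ∏ k, pauliPower (u k) (e k) (b k) (a k)

/-- The sign of the outcome `β` on the Pauli string with support `e`. -/
def stringSign {n m : ℕ} (β e : Outcome n m) : ℂ :=
  ∏ k, if e k = 0 then 1 else outcomeSign (β k)

lemma norm_stringSign {n m : ℕ} (β e : Outcome n m) : ‖stringSign β e‖ = 1 := by
  rw [stringSign, norm_prod]
  refine Finset.prod_eq_one fun k _ => ?_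
  rw [outcomeSign]
  split_ifs <;> simp

lemma trace_mul_snapshot {n m : ℕ} (O : Op n m) (u : Setting n m) (β : Outcome n m) :
    (O * snapshot u β).trace = (1 / 2 : ℂ) ^ (n + m) *
      ∑ e, (supportWeight e : ℂ) * (stringSign β e * pauliCoeff O u e) := by
  have h : ∀ a b : Outcome n m, snapshot u β (label b) (label a) = (1 / 2 : ℂ) ^ (n + m) *
      ∑ e : Outcome n m, (supportWeight e : ℂ) * (stringSign β e *
        ∏ k, pauliPower (u k) (e k) (b k) (a k)) := fun a b => by
    have h1 : ∀ k, qubitSnapshot (u k) (β k) (b k) (a k) = 1 / 2 * ∑ c : Fin 2,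
        ((if c = 0 then 1 else 3) * ((if c = 0 then 1 else outcomeSign (β k)) *
          pauliPower (u k) c (b k) (a k))) := fun k => by
      rw [qubitSnapshot_apply]
      simp [pauliPower, Fin.sum_univ_two, Matrix.one_apply]
      ring
    rw [snapshot_label, Finset.prod_congr rfl fun k _ => h1 k, Finset.prod_mul_distrib,
      prod_const_qubits, Fintype.prod_sum]
    congr 1
    refine Finset.sum_congr rfl fun e _ => ?_
    rw [Finset.prod_mul_distrib, Finset.prod_mul_distrib, supportWeight, stringSign,
      Complex.ofReal_prod]
    congr 1
    exact Finset.prod_congr rfl fun k _ => by split_ifs <;> simp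
  rw [trace_mul_eq_sum_label]
  simp only [h, pauliCoeff, Finset.mul_sum]
  rw [Finset.sum_congr rfl fun a _ => Finset.sum_comm, Finset.sum_comm]
  refine Finset.sum_congr rfl fun e _ => Finset.sum_congr rfl fun a _ =>
    Finset.sum_congr rfl fun b _ => ?_
  ring

/-- Cauchy-Schwarz with the weights 3^|e|, whose total 4^(n+m) cancels the square of the prefactor
2^-(n+m). The outcome enters only through signs, which disappear; the resulting bound depends on the
gates alone, so the state drops out of the second moment. -/
lemma norm_trace_mul_snapshot_sq_le {n m : ℕ} (O : Op n m) (u : Setting n m) (β : Outcome n m) :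
    ‖(O * snapshot u β).trace‖ ^ 2 ≤ ∑ e, supportWeight e * ‖pauliCoeff O u e‖ ^ 2 := by
  rw [trace_mul_snapshot, norm_mul, mul_pow]
  have h1 : ‖∑ e, (supportWeight e : ℂ) * (stringSign β e * pauliCoeff O u e)‖ ≤
      ∑ e, supportWeight e * ‖pauliCoeff O u e‖ := by
    refine (norm_sum_le _ _).trans (Finset.sum_le_sum fun e _ => ?_)
    rw [norm_mul, norm_mul, norm_stringSign, one_mul, Complex.norm_real,
      Real.norm_of_nonneg (supportWeight_nonneg e)]
  have h2 : (∑ e, supportWeight e * ‖pauliCoeff O u e‖) ^ 2 ≤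
      (∑ e : Outcome n m, supportWeight e) * ∑ e, supportWeight e * ‖pauliCoeff O u e‖ ^ 2 :=
    Finset.sum_sq_le_sum_mul_sum_of_sq_le_mul _ (fun e _ => supportWeight_nonneg e)
      (fun e _ => mul_nonneg (supportWeight_nonneg e) (by positivity)) (fun e _ => le_of_eq (by ring))
  rw [sum_supportWeight] at h2
  have h3 : ‖(1 / 2 : ℂ) ^ (n + m)‖ ^ 2 * 4 ^ (n + m) = 1 := by
    rw [norm_pow, ← pow_mul, mul_comm (n + m) 2, pow_mul, ← mul_pow]
    norm_num
  calc _ ≤ ‖(1 / 2 : ℂ) ^ (n + m)‖ ^ 2 * (∑ e, supportWeight e * ‖pauliCoeff O u e‖) ^ 2 := by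
        gcongr
    _ ≤ ‖(1 / 2 : ℂ) ^ (n + m)‖ ^ 2 *
        (4 ^ (n + m) * ∑ e, supportWeight e * ‖pauliCoeff O u e‖ ^ 2) := by gcongr
    _ = _ := by rw [← mul_assoc, h3, one_mul]

/-- Parseval: a Pauli string with support e is measured with probability 3^-|e|, which the support
weight cancels. The average over gates is therefore the sum of |tr(O P)|² over all Pauli strings P.
-/
lemma sum_pauliCoeff_sq {n m : ℕ} (O : Op n m) :
    ∑ u : Setting n m, ∑ e, supportWeight e * ‖pauliCoeff O u e‖ ^ 2 =
      (Nat.card clifford : ℝ) ^ (n + m) * (2 ^ (n + m) * ∑ x, ∑ y, ‖O x y‖ ^ 2) := by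
  have hn : ∀ z : ℂ, ((‖z‖ ^ 2 : ℝ) : ℂ) = z * star z := fun z => by
    rw [Complex.star_def, Complex.mul_conj, Complex.normSq_eq_norm_sq]
  have hq : ∀ a b c d : Outcome n m, ∑ u : Setting n m, ∑ e : Outcome n m,
      ((∏ k, if e k = 0 then (1 : ℂ) else 3) * ((∏ k, pauliPower (u k) (e k) (b k) (a k)) *
        star (∏ k, pauliPower (u k) (e k) (d k) (c k)))) =
      (Nat.card clifford : ℂ) ^ (n + m) * 2 ^ (n + m) * if b = d ∧ a = c then 1 else 0 := by
    intro a b c d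
    simp only [star_prod, ← Finset.prod_mul_distrib]
    rw [sum_prod_qubits fun k (g : clifford) (r : Fin 2) => (if r = 0 then (1 : ℂ) else 3) *
      (pauliPower g r (b k) (a k) * star (pauliPower g r (d k) (c k)))]
    have : ∀ k, ∑ g : clifford, ∑ r : Fin 2, (if r = 0 then (1 : ℂ) else 3) *
        (pauliPower g r (b k) (a k) * star (pauliPower g r (d k) (c k))) =
        Nat.card clifford * (2 * if b k = d k ∧ a k = c k then 1 else 0) := fun k => by
      rw [← sum_one_add_measuredPauli]
      refine Finset.sum_congr rfl fun g _ => ?_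
      simp only [pauliPower, Fin.sum_univ_two, if_true, one_ne_zero, if_false, Matrix.one_apply,
        one_mul]
      congr 2
      split_ifs <;> simp
    rw [Finset.prod_congr rfl fun k _ => this k, Finset.prod_mul_distrib, Finset.prod_mul_distrib,
      prod_const_qubits, prod_const_qubits, prod_ite_eq_and, mul_assoc]
  have hC : (∑ u : Setting n m, ∑ e, (supportWeight e : ℂ) *
      (pauliCoeff O u e * star (pauliCoeff O u e))) =
      (Nat.card clifford : ℂ) ^ (n + m) * (2 ^ (n + m) * ∑ x, ∑ y, O x y * star (O x y)) := by
    have hexp : ∀ (u : Setting n m) (e : Outcome n m), (supportWeight e : ℂ) *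
        (pauliCoeff O u e * star (pauliCoeff O u e)) =
        ∑ p : Outcome n m × Outcome n m, ∑ q : Outcome n m × Outcome n m,
          O (label p.1) (label p.2) * star (O (label q.1) (label q.2)) *
          ((∏ k, if e k = 0 then (1 : ℂ) else 3) *
            ((∏ k, pauliPower (u k) (e k) (p.2 k) (p.1 k)) *
              star (∏ k, pauliPower (u k) (e k) (q.2 k) (q.1 k)))) := fun u e => by
      have hw : (supportWeight e : ℂ) = ∏ k, if e k = 0 then (1 : ℂ) else 3 := by
        rw [supportWeight, Complex.ofReal_prod]
        exact Finset.prod_congr rfl fun k _ => by split_ifs <;> simp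
      rw [pauliCoeff, ← Fintype.sum_prod_type', star_sum, Finset.sum_mul_sum, Finset.mul_sum, hw]
      refine Finset.sum_congr rfl fun p _ => ?_
      rw [Finset.mul_sum]
      refine Finset.sum_congr rfl fun q _ => ?_
      rw [star_mul']
      ring
    simp only [hexp]
    rw [sum_comm_pairs]
    simp only [← Finset.mul_sum, hq]
    have hO : ∀ p q : Outcome n m × Outcome n m, (if p.2 = q.2 ∧ p.1 = q.1 then (1 : ℂ) else 0) =
        if p = q then 1 else 0 := fun p q => by
      simp only [Prod.ext_iff, and_comm]
    simp only [hO, mul_ite, mul_one, mul_zero, Finset.sum_ite_eq, Finset.mem_univ, if_true]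
    rw [Fintype.sum_prod_type, ← sum_label, Finset.mul_sum, Finset.mul_sum]
    refine Finset.sum_congr rfl fun a _ => ?_
    rw [← sum_label, Finset.mul_sum, Finset.mul_sum]
    refine Finset.sum_congr rfl fun b _ => ?_
    ring
  rw [← Complex.ofReal_inj]
  push_cast
  simp only [← Complex.ofReal_pow, hn]
  exact hC

/-- The second moment of a snapshot expectation value is at most `2 ^ (n + m)` times the squared
Hilbert-Schmidt norm of the observable. -/
lemma sum_recordProb_mul_norm_sq_le {n m : ℕ} {ρ : Op n m} (hρ : IsState ρ) (O : Op n m) :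
    ∑ s, recordProb ρ s * ‖(O * snapshot s.1 s.2).trace‖ ^ 2 ≤
      2 ^ (n + m) * ∑ x, ∑ y, ‖O x y‖ ^ 2 := by
  have hc := pow_pos card_clifford_pos (n + m)
  rw [Fintype.sum_prod_type]
  calc ∑ u, ∑ β, recordProb ρ (u, β) * ‖(O * snapshot u β).trace‖ ^ 2
      ≤ ∑ u : Setting n m, ∑ β, recordProb ρ (u, β) *
        ∑ e, supportWeight e * ‖pauliCoeff O u e‖ ^ 2 :=
        Finset.sum_le_sum fun u _ => Finset.sum_le_sum fun β _ =>
          mul_le_mul_of_nonneg_left (norm_trace_mul_snapshot_sq_le O u β) (recordProb_nonneg hρ _)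
    _ = ((Nat.card clifford : ℝ) ^ (n + m))⁻¹ *
        ∑ u : Setting n m, ∑ e, supportWeight e * ‖pauliCoeff O u e‖ ^ 2 := by
        simp only [recordProb, ← Finset.sum_mul, ← Finset.mul_sum, sum_bornProb hρ, mul_one]
    _ = _ := by rw [sum_pauliCoeff_sq, inv_mul_cancel_left₀ hc.ne']

lemma sum_two_copies {n m : ℕ} {M : Type*} [AddCommMonoid M] (f : AB n m × AB n m → M) :
    ∑ x, f x = ∑ x, ∑ y, f (x, y) :=
  Fintype.sum_prod_type f

/-- The second moment bound for a two-copy observable and two independent snapshots. -/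
lemma sum_recordProb_mul_norm_sq_kronecker_le {n m : ℕ} {ρ τ : Op n m} (hρ : IsState ρ)
    (hτ : IsState τ) (Z : Op2 n m) :
    ∑ s, recordProb ρ s * ∑ t, recordProb τ t *
      ‖(Z * (snapshot s.1 s.2 ⊗ₖ snapshot t.1 t.2)).trace‖ ^ 2 ≤
      2 ^ (n + m) * (2 ^ (n + m) * ∑ x, ∑ y, ‖Z x y‖ ^ 2) := by
  -- `S σ` is Z contracted with σ on the first copy, an observable on the second copy, and each of
  -- its entries is an expectation value tr(`T x y` σ). The one-copy bound thus applies twice, each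
  -- time at the cost of a factor 2^(n+m).
  let S (σ : Op n m) : Op n m := fun x y => ∑ x', ∑ y', Z (x', x) (y', y) * σ y' x'
  let T (x y : AB n m) : Op n m := fun x' y' => Z (x', x) (y', y)
  have hS : ∀ σ σ' : Op n m, (Z * (σ ⊗ₖ σ')).trace = (S σ * σ').trace := fun σ σ' => by
    simp only [Matrix.trace, Matrix.diag_apply, Matrix.mul_apply, S, sum_two_copies,
      Matrix.kroneckerMap_apply]
    rw [Finset.sum_comm]
    refine Finset.sum_congr rfl fun x _ => ?_
    rw [Finset.sum_congr rfl fun x' _ => Finset.sum_comm, Finset.sum_comm]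
    refine Finset.sum_congr rfl fun y _ => ?_
    change _ = (∑ x', ∑ y', Z (x', x) (y', y) * σ y' x') * σ' y x
    rw [Finset.sum_mul]
    refine Finset.sum_congr rfl fun x' _ => ?_
    rw [Finset.sum_mul]
    exact Finset.sum_congr rfl fun y' _ => (mul_assoc _ _ _).symm
  have hT : ∀ (σ : Op n m) (x y : AB n m), S σ x y = (T x y * σ).trace := fun σ x y => by
    simp only [Matrix.trace, Matrix.diag_apply, S, T]
    rfl
  calc _ ≤ ∑ s, recordProb ρ s * (2 ^ (n + m) * ∑ x, ∑ y, ‖S (snapshot s.1 s.2) x y‖ ^ 2) := by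
        refine Finset.sum_le_sum fun s _ => mul_le_mul_of_nonneg_left ?_ (recordProb_nonneg hρ s)
        simp only [hS]
        exact sum_recordProb_mul_norm_sq_le hτ _
    _ = 2 ^ (n + m) * ∑ x, ∑ y, ∑ s, recordProb ρ s * ‖(T x y * snapshot s.1 s.2).trace‖ ^ 2 := by
        simp only [hT, Finset.mul_sum]
        rw [Finset.sum_comm]
        refine Finset.sum_congr rfl fun x _ => ?_
        rw [Finset.sum_comm]
        refine Finset.sum_congr rfl fun y _ => Finset.sum_congr rfl fun s _ => ?_
        ring
    _ ≤ 2 ^ (n + m) * ∑ x, ∑ y, 2 ^ (n + m) * ∑ x', ∑ y', ‖T x y x' y'‖ ^ 2 := by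
        gcongr with x _ y _
        exact sum_recordProb_mul_norm_sq_le hρ _
    _ = _ := by
        simp only [← Finset.mul_sum, T]
        congr 2
        simp only [sum_two_copies]
        rw [Finset.sum_congr rfl fun x _ => Finset.sum_comm, Finset.sum_comm]
        refine Finset.sum_congr rfl fun x' _ => Finset.sum_congr rfl fun x _ => ?_
        rw [Finset.sum_comm]

/-! The two-copy observable in coordinates -/

/-- The indicator function of the sector `i`. -/
def sectorInd {n m : ℕ} (i : ℤ) (x : AB n m) : ℝ :=
  if (weight x.1 : ℤ) - (weight x.2 : ℤ) = i then 1 else 0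

/-- The coefficient with which the swap of `x` and `y` enters the two-copy observable. -/
def swapCoeff {n m : ℕ} (i : ℤ) (x y : AB n m) : ℝ :=
  (sectorInd i (y.1, x.2) + sectorInd i (x.1, y.2)) / 2

lemma sectorInd_nonneg {n m : ℕ} (i : ℤ) (x : AB n m) : 0 ≤ sectorInd i x := by
  rw [sectorInd]; split_ifs <;> norm_num

lemma sectorInd_le_one {n m : ℕ} (i : ℤ) (x : AB n m) : sectorInd i x ≤ 1 := by
  rw [sectorInd]; split_ifs <;> norm_num

lemma sectorInd_mul_self {n m : ℕ} (i : ℤ) (x : AB n m) :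
    sectorInd i x * sectorInd i x = sectorInd i x := by
  rw [sectorInd]; split_ifs <;> norm_num

lemma swapCoeff_nonneg {n m : ℕ} (i : ℤ) (x y : AB n m) : 0 ≤ swapCoeff i x y :=
  div_nonneg (add_nonneg (sectorInd_nonneg _ _) (sectorInd_nonneg _ _)) zero_le_two

lemma swapCoeff_le_one {n m : ℕ} (i : ℤ) (x y : AB n m) : swapCoeff i x y ≤ 1 := by
  have h1 := sectorInd_le_one i (y.1, x.2)
  have h2 := sectorInd_le_one i (x.1, y.2)
  rw [swapCoeff]; linarith

lemma swapCoeff_self {n m : ℕ} (i : ℤ) (x : AB n m) : swapCoeff i x x = sectorInd i x := by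
  rw [swapCoeff]; simp

lemma swapCoeff_comm {n m : ℕ} (i : ℤ) (x y : AB n m) : swapCoeff i x y = swapCoeff i y x := by
  rw [swapCoeff, swapCoeff, add_comm]

lemma weight_le {n : ℕ} (x : Bits n) : weight x ≤ n := by
  have : weight x ≤ ∑ _k : Fin n, 1 := Finset.sum_le_sum fun k _ => by omega
  simpa using this

lemma sectorProj_eq {n m : ℕ} (i : ℤ) :
    sectorProj n m i = Matrix.diagonal fun x => (sectorInd i x : ℂ) := by
  have h : ∀ a b : ℕ, weightProj n a ⊗ₖ weightProj m b =
      Matrix.diagonal fun x : AB n m => if (weight x.1, weight x.2) = (a, b) then (1 : ℂ) else 0 := by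
    intro a b
    rw [weightProj, weightProj, Matrix.diagonal_kronecker_diagonal]
    congr 1
    funext x
    simp only [Prod.mk.injEq, ite_and, ite_mul, one_mul, zero_mul]
  simp only [sectorProj, h]
  ext x y
  rw [Matrix.sum_apply]
  by_cases hxy : x = y
  · subst hxy
    simp only [Matrix.diagonal_apply_eq, sectorInd]
    rw [Finset.sum_ite_eq]
    have h1 := weight_le x.1
    have h2 := weight_le x.2
    simp [h1, h2, apply_ite (Complex.ofReal)]
  · simp [Matrix.diagonal_apply_ne _ hxy]

lemma trace_sectorProj_mul {n m : ℕ} (i : ℤ) (ρ : Op n m) :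
    (sectorProj n m i * ρ).trace = ∑ x, (sectorInd i x : ℂ) * ρ x x := by
  rw [sectorProj_eq]
  simp [Matrix.trace, Matrix.diagonal_mul]

lemma sectorDim_eq (n m : ℕ) (i : ℤ) : sectorDim n m i = ∑ x : AB n m, sectorInd i x := by
  rw [sectorDim, sectorProj_eq, Matrix.trace_diagonal, ← Complex.ofReal_sum, Complex.ofReal_re]

lemma exists_weight_eq {n a : ℕ} (h : a ≤ n) : ∃ x : Bits n, weight x = a := by
  refine ⟨fun k => if (k : ℕ) < a then 1 else 0, ?_⟩
  have : ∀ k : Fin n, (((if (k : ℕ) < a then 1 else 0 : Fin 2)) : ℕ) =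
      if (k : ℕ) < a then 1 else 0 :=
    fun k => by split_ifs <;> rfl
  simp only [weight, this]
  rw [Finset.sum_boole, Fin.card_filter_val_lt]
  simpa using h

lemma one_le_sectorDim {n m : ℕ} {i : ℤ} (hi : -(m : ℤ) ≤ i ∧ i ≤ (n : ℤ)) :
    1 ≤ sectorDim n m i := by
  -- The integer i is the difference of its positive and negative parts, and its range says
  -- precisely that they fit into A and B.
  obtain ⟨a, ha⟩ := exists_weight_eq (n := n) (a := i.toNat) (by omega)
  obtain ⟨b, hb⟩ := exists_weight_eq (n := m) (a := (-i).toNat) (by omega)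
  have h : sectorInd i ((a, b) : AB n m) = 1 := by
    rw [sectorInd, if_pos]
    simp only [ha, hb]
    omega
  rw [sectorDim_eq, ← h]
  exact Finset.single_le_sum (fun x _ => sectorInd_nonneg i x) (Finset.mem_univ _)

lemma swapA_mul_mul_swapB_apply {n m : ℕ} (P : AB n m × AB n m → ℂ) (x y : AB n m × AB n m) :
    (swapA n m * Matrix.diagonal P * swapB n m) x y =
      if y = x.swap then P ((x.2.1, x.1.2), (x.1.1, x.2.2)) else 0 := by
  have hA : ∀ z : AB n m × AB n m, x = ((z.2.1, z.1.2), (z.1.1, z.2.2)) ↔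
      z = ((x.2.1, x.1.2), (x.1.1, x.2.2)) := fun z => by
    obtain ⟨⟨_, _⟩, ⟨_, _⟩⟩ := z; obtain ⟨⟨_, _⟩, ⟨_, _⟩⟩ := x
    simp only [Prod.mk.injEq]; tauto
  have hy : ((x.2.1, x.1.2), (x.1.1, x.2.2)) = ((y.1.1, y.2.2), (y.2.1, y.1.2)) ↔ y = x.swap := by
    obtain ⟨⟨_, _⟩, ⟨_, _⟩⟩ := y; obtain ⟨⟨_, _⟩, ⟨_, _⟩⟩ := x
    simp only [Prod.mk.injEq, Prod.swap]; tauto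
  rw [Matrix.mul_apply, Finset.sum_eq_single ((x.2.1, x.1.2), (x.1.1, x.2.2))]
  · simp only [Matrix.mul_diagonal, swapA, swapB, Matrix.of_apply, hy, if_true, one_mul, mul_ite,
      mul_one, mul_zero]
  · intro z _ hz
    simp only [Matrix.mul_diagonal, swapA, Matrix.of_apply, hA, hz, if_false, zero_mul]
  · simp

lemma swapB_mul_mul_swapA_apply {n m : ℕ} (P : AB n m × AB n m → ℂ) (x y : AB n m × AB n m) :
    (swapB n m * Matrix.diagonal P * swapA n m) x y =
      if y = x.swap then P ((x.1.1, x.2.2), (x.2.1, x.1.2)) else 0 := by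
  have hB : ∀ z : AB n m × AB n m, x = ((z.1.1, z.2.2), (z.2.1, z.1.2)) ↔
      z = ((x.1.1, x.2.2), (x.2.1, x.1.2)) := fun z => by
    obtain ⟨⟨_, _⟩, ⟨_, _⟩⟩ := z; obtain ⟨⟨_, _⟩, ⟨_, _⟩⟩ := x
    simp only [Prod.mk.injEq]; tauto
  have hy : ((x.1.1, x.2.2), (x.2.1, x.1.2)) = ((y.2.1, y.1.2), (y.1.1, y.2.2)) ↔ y = x.swap := by
    obtain ⟨⟨_, _⟩, ⟨_, _⟩⟩ := y; obtain ⟨⟨_, _⟩, ⟨_, _⟩⟩ := x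
    simp only [Prod.mk.injEq, Prod.swap]; tauto
  rw [Matrix.mul_apply, Finset.sum_eq_single ((x.1.1, x.2.2), (x.2.1, x.1.2))]
  · simp only [Matrix.mul_diagonal, swapA, swapB, Matrix.of_apply, hy, if_true, one_mul, mul_ite,
      mul_one, mul_zero]
  · intro z _ hz
    simp only [Matrix.mul_diagonal, swapB, Matrix.of_apply, hB, hz, if_false, zero_mul]
  · simp

/-- Q is a diagonal matrix minus a weighted swap of the two copies, so each row has at most two
nonzero entries. Averaging the two orders of `swapA` and `swapB` makes the swap weight symmetric. -/
lemma obsQ_apply {n m : ℕ} (i : ℤ) (x y : AB n m × AB n m) :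
    obsQ n m i x y =
      (((if y = x then sectorInd i x.1 * sectorInd i x.2 else 0) -
        if y = x.swap then swapCoeff i x.1 x.2 else 0 : ℝ) : ℂ) := by
  have h1 : (1 : Op n m) = Matrix.diagonal fun _ => 1 := Matrix.diagonal_one.symm
  rw [obsQ, sectorProj_eq, h1, Matrix.diagonal_kronecker_diagonal,
    Matrix.diagonal_kronecker_diagonal, Matrix.sub_apply, Matrix.sub_apply, Matrix.smul_apply,
    Matrix.smul_apply, swapA_mul_mul_swapB_apply, swapB_mul_mul_swapA_apply, Matrix.diagonal_apply]
  simp only [eq_comm (a := x) (b := y), swapCoeff, smul_eq_mul]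
  split_ifs <;> push_cast <;> ring

lemma trace_obsQ_mul_kronecker {n m : ℕ} (i : ℤ) (σ τ : Op n m) :
    (obsQ n m i * (σ ⊗ₖ τ)).trace =
      (∑ x, (sectorInd i x : ℂ) * σ x x) * (∑ x, (sectorInd i x : ℂ) * τ x x) -
        ∑ x, ∑ y, (swapCoeff i x y : ℂ) * σ y x * τ x y := by
  simp only [Matrix.trace, Matrix.diag_apply, Matrix.mul_apply, obsQ_apply,
    Matrix.kroneckerMap_apply]
  have h : ∀ x : AB n m × AB n m, ∑ y : AB n m × AB n m,
      (((if y = x then sectorInd i x.1 * sectorInd i x.2 else 0) -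
        if y = x.swap then swapCoeff i x.1 x.2 else 0 : ℝ) : ℂ) * (σ y.1 x.1 * τ y.2 x.2) =
      (sectorInd i x.1 * σ x.1 x.1) * (sectorInd i x.2 * τ x.2 x.2) -
        swapCoeff i x.1 x.2 * σ x.2 x.1 * τ x.1 x.2 := fun x => by
    have h1 : ∀ y : AB n m × AB n m,
        (((if y = x then sectorInd i x.1 * sectorInd i x.2 else 0) -
        if y = x.swap then swapCoeff i x.1 x.2 else 0 : ℝ) : ℂ) * (σ y.1 x.1 * τ y.2 x.2) =
        (if y = x then (sectorInd i x.1 * sectorInd i x.2 : ℂ) * (σ y.1 x.1 * τ y.2 x.2) else 0) -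
        if y = x.swap then (swapCoeff i x.1 x.2 : ℂ) * (σ y.1 x.1 * τ y.2 x.2) else 0 := fun y => by
      split_ifs <;> push_cast <;> ring
    rw [Finset.sum_congr rfl fun y _ => h1 y, Finset.sum_sub_distrib, Finset.sum_ite_eq',
      Finset.sum_ite_eq', if_pos (Finset.mem_univ _), if_pos (Finset.mem_univ _)]
    simp only [Prod.fst_swap, Prod.snd_swap]
    ring
  simp only [h, Finset.sum_sub_distrib, sum_two_copies]
  rw [Finset.sum_mul_sum]

lemma sum_prod_swap_parts {n m : ℕ} (f g : AB n m → ℝ) :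
    ∑ x : AB n m, ∑ y : AB n m, f (y.1, x.2) * g (x.1, y.2) = (∑ x, f x) * ∑ x, g x := by
  rw [Finset.sum_mul_sum, ← sum_two_copies fun z : AB n m × AB n m =>
      f (z.2.1, z.1.2) * g (z.1.1, z.2.2), ← sum_two_copies fun z : AB n m × AB n m => f z.1 * g z.2]
  let e : AB n m × AB n m → AB n m × AB n m := fun z => ((z.2.1, z.1.2), (z.1.1, z.2.2))
  have he : Function.Involutive e := fun z => rfl
  exact Fintype.sum_equiv he.toPerm _ _ fun z => rfl

/-- The diagonal part contributes D². The squared swap weights contribute Dd/2 from the two pure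
squares and D²/2 from their product. The two parts overlap only where both copies carry the same
label, and this cross term is -2D. -/
lemma sum_norm_obsQ_sq (n m : ℕ) (i : ℤ) :
    ∑ x, ∑ y, ‖obsQ n m i x y‖ ^ 2 =
      3 / 2 * sectorDim n m i ^ 2 - 2 * sectorDim n m i + sectorDim n m i * 2 ^ (n + m) / 2 := by
  have h : ∀ x : AB n m × AB n m, ∑ y, ‖obsQ n m i x y‖ ^ 2 =
      sectorInd i x.1 * sectorInd i x.2 - (if x.1 = x.2 then 2 * sectorInd i x.1 else 0) +
        swapCoeff i x.1 x.2 ^ 2 := fun x => by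
    have h1 : ∀ y : AB n m × AB n m, ‖obsQ n m i x y‖ ^ 2 =
        (if y = x then (sectorInd i x.1 * sectorInd i x.2) ^ 2 - (if x = x.swap then
          2 * (sectorInd i x.1 * sectorInd i x.2) * swapCoeff i x.1 x.2 else 0) else 0) +
        if y = x.swap then swapCoeff i x.1 x.2 ^ 2 else 0 := fun y => by
      rw [obsQ_apply, Complex.norm_real, Real.norm_eq_abs, sq_abs]
      by_cases h1 : y = x
      · subst h1
        simp only [if_true]
        split_ifs <;> ring
      · simp only [h1, if_false]
        split_ifs <;> ring
    have h2 : x = x.swap ↔ x.1 = x.2 := by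
      rw [Prod.ext_iff]; simp [eq_comm]
    rw [Finset.sum_congr rfl fun y _ => h1 y, Finset.sum_add_distrib, Finset.sum_ite_eq',
      Finset.sum_ite_eq', if_pos (Finset.mem_univ _), if_pos (Finset.mem_univ _)]
    simp only [h2]
    congr 2
    · rw [mul_pow, pow_two, pow_two, sectorInd_mul_self, sectorInd_mul_self]
    · split_ifs with h3
      · rw [h3, swapCoeff_self, sectorInd_mul_self, mul_assoc, sectorInd_mul_self]
      · rfl
  have hc : ∀ x y : AB n m, swapCoeff i x y ^ 2 =
      1 / 4 * sectorInd i (y.1, x.2) + 1 / 4 * sectorInd i (x.1, y.2) +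
        1 / 2 * (sectorInd i (y.1, x.2) * sectorInd i (x.1, y.2)) := fun x y => by
    have h1 := sectorInd_mul_self i (y.1, x.2)
    have h2 := sectorInd_mul_self i (x.1, y.2)
    rw [swapCoeff]
    linear_combination (h1 + h2) / 4
  have s1 := sum_prod_swap_parts (n := n) (m := m) (sectorInd i) fun _ => 1
  have s2 := sum_prod_swap_parts (n := n) (m := m) (fun _ => 1) (sectorInd i)
  have s3 := sum_prod_swap_parts (n := n) (m := m) (sectorInd i) (sectorInd i)
  have hcard : ∑ _x : AB n m, (1 : ℝ) = 2 ^ (n + m) := by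
    simp [pow_add]
  rw [← sectorDim_eq, hcard] at s1 s2
  simp only [mul_one, one_mul] at s1 s2
  rw [← sectorDim_eq] at s3
  simp only [h]
  rw [sum_two_copies]
  simp only [Finset.sum_add_distrib, Finset.sum_sub_distrib, hc, ← Finset.mul_sum, s1, s2, s3,
    Finset.sum_ite_eq, Finset.mem_univ, if_true, ← Finset.sum_mul, ← sectorDim_eq]
  ring

/-! The bilinear form of the two-copy observable -/

/-- The real part of `tr (Q (σ ⊗ τ))`, as a real bilinear form. -/
def pairing {n m : ℕ} (i : ℤ) : Op n m →ₗ[ℝ] Op n m →ₗ[ℝ] ℝ :=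
  LinearMap.mk₂ ℝ (fun σ τ => ((obsQ n m i * (σ ⊗ₖ τ)).trace).re)
    (fun σ σ' τ => by
      rw [Matrix.add_kronecker, Matrix.mul_add, Matrix.trace_add, Complex.add_re])
    (fun c σ τ => by
      rw [Matrix.smul_kronecker, Matrix.mul_smul, Matrix.trace_smul, Complex.smul_re])
    (fun σ τ τ' => by
      rw [Matrix.kronecker_add, Matrix.mul_add, Matrix.trace_add, Complex.add_re])
    (fun c σ τ => by
      rw [Matrix.kronecker_smul, Matrix.mul_smul, Matrix.trace_smul, Complex.smul_re])

lemma pairing_apply {n m : ℕ} (i : ℤ) (σ τ : Op n m) :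
    pairing i σ τ = ((obsQ n m i * (σ ⊗ₖ τ)).trace).re := rfl

lemma pairing_comm {n m : ℕ} (i : ℤ) (σ τ : Op n m) : pairing i σ τ = pairing i τ σ := by
  rw [pairing_apply, pairing_apply, trace_obsQ_mul_kronecker, trace_obsQ_mul_kronecker, mul_comm]
  congr 2
  rw [Finset.sum_comm]
  refine Finset.sum_congr rfl fun x _ => Finset.sum_congr rfl fun y _ => ?_
  rw [swapCoeff_comm]
  ring

/-- The one-copy observable that remains of the two-copy observable when the second copy is in the
state `τ`. -/
def reducedObs {n m : ℕ} (i : ℤ) (τ : Op n m) : Op n m := fun x y =>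
  (if x = y then (sectorProj n m i * τ).trace * sectorInd i x else 0) - swapCoeff i x y * τ x y

lemma trace_obsQ_mul_eq_reducedObs {n m : ℕ} (i : ℤ) (σ τ : Op n m) :
    (obsQ n m i * (σ ⊗ₖ τ)).trace = (reducedObs i τ * σ).trace := by
  rw [trace_obsQ_mul_kronecker]
  simp only [Matrix.trace, Matrix.diag_apply, Matrix.mul_apply (M := reducedObs i τ), reducedObs,
    sub_mul, Finset.sum_sub_distrib, ite_mul, zero_mul, Finset.sum_ite_eq, Finset.mem_univ, if_true]
  congr 1
  · rw [← trace_sectorProj_mul i τ, Finset.sum_mul]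
    exact Finset.sum_congr rfl fun x _ => by simp only [Matrix.trace, Matrix.diag_apply]; ring
  · exact Finset.sum_congr rfl fun x _ => Finset.sum_congr rfl fun y _ => by ring

lemma reducedObs_sum {n m : ℕ} {ι : Type*} (i : ℤ) (s : Finset ι) (τ : ι → Op n m) (x y : AB n m) :
    reducedObs i (∑ k ∈ s, τ k) x y = ∑ k ∈ s, reducedObs i (τ k) x y := by
  simp only [reducedObs, Finset.sum_sub_distrib, Finset.mul_sum, Matrix.trace_sum, Matrix.sum_apply,
    Finset.sum_mul]
  split_ifs <;> simp

/-- The linear term of a round involves the sum of all the other states, while `C1` controls one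
state at a time; Cauchy-Schwarz links the two. -/
lemma sum_norm_reducedObs_sum_le {n m : ℕ} {ι : Type*} (i : ℤ) (s : Finset ι) (τ : ι → Op n m)
    {c : ℝ} (h : ∀ k ∈ s, ∑ x, ∑ y, ‖reducedObs i (τ k) x y‖ ^ 2 ≤ c) :
    ∑ x, ∑ y, ‖reducedObs i (∑ k ∈ s, τ k) x y‖ ^ 2 ≤ (s.card : ℝ) ^ 2 * c := by
  calc _ ≤ ∑ x, ∑ y, (s.card : ℝ) * ∑ k ∈ s, ‖reducedObs i (τ k) x y‖ ^ 2 := by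
        gcongr with x _ y _
        rw [reducedObs_sum]
        exact (pow_le_pow_left₀ (norm_nonneg _) (norm_sum_le _ _) 2).trans
          sq_sum_le_card_mul_sum_sq
    _ = (s.card : ℝ) * ∑ k ∈ s, ∑ x, ∑ y, ‖reducedObs i (τ k) x y‖ ^ 2 := by
        simp only [← Finset.mul_sum]
        congr 1
        rw [Finset.sum_congr rfl fun x _ => Finset.sum_comm, Finset.sum_comm]
    _ ≤ (s.card : ℝ) * ∑ k ∈ s, c := by gcongr with k hk; exact h k hk
    _ = _ := by rw [Finset.sum_const, nsmul_eq_mul]; ring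

/-! Bounds for states -/

lemma IsState.star_apply {n m : ℕ} {ρ : Op n m} (hρ : IsState ρ) (x y : AB n m) :
    star (ρ x y) = ρ y x :=
  hρ.1.isHermitian.apply y x

lemma IsState.diag_eq {n m : ℕ} {ρ : Op n m} (hρ : IsState ρ) (x : AB n m) :
    ρ x x = ((ρ x x).re : ℂ) :=
  (Complex.conj_eq_iff_re.mp (hρ.star_apply x x)).symm

lemma IsState.diag_nonneg {n m : ℕ} {ρ : Op n m} (hρ : IsState ρ) (x : AB n m) :
    0 ≤ (ρ x x).re :=
  (Complex.nonneg_iff.mp hρ.1.diag_nonneg).1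

lemma IsState.sum_diag {n m : ℕ} {ρ : Op n m} (hρ : IsState ρ) : ∑ x, (ρ x x).re = 1 := by
  rw [← Complex.re_sum]
  have := hρ.2
  rw [Matrix.trace] at this
  simp only [Matrix.diag_apply] at this
  rw [this, Complex.one_re]

/-- The purity is at most 1, because positivity of the 2 × 2 principal minors bounds |ρ x y|² by ρ x
x ρ y y. -/
lemma IsState.sum_norm_sq_le {n m : ℕ} {ρ : Op n m} (hρ : IsState ρ) :
    ∑ x, ∑ y, ‖ρ x y‖ ^ 2 ≤ 1 := by
  have h : ∀ x y, ‖ρ x y‖ ^ 2 ≤ (ρ x x).re * (ρ y y).re := fun x y => by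
    have h1 := (hρ.1.submatrix ![x, y]).det_nonneg
    rw [Matrix.det_fin_two] at h1
    simp only [Matrix.submatrix_apply, Matrix.cons_val_zero, Matrix.cons_val_one] at h1
    rw [← hρ.star_apply x y, Complex.star_def, Complex.mul_conj, Complex.normSq_eq_norm_sq,
      hρ.diag_eq x, hρ.diag_eq y] at h1
    have h2 := (Complex.nonneg_iff.mp h1).1
    simp only [← Complex.ofReal_mul, ← Complex.ofReal_sub, Complex.ofReal_re] at h2
    linarith
  calc _ ≤ ∑ x, ∑ y, (ρ x x).re * (ρ y y).re :=
        Finset.sum_le_sum fun x _ => Finset.sum_le_sum fun y _ => h x y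
    _ = 1 := by rw [← Finset.sum_mul_sum, hρ.sum_diag, one_mul]

lemma IsState.trace_sectorProj_mul_eq {n m : ℕ} {ρ : Op n m} (hρ : IsState ρ) (i : ℤ) :
    (sectorProj n m i * ρ).trace = ((∑ x, sectorInd i x * (ρ x x).re : ℝ) : ℂ) := by
  rw [trace_sectorProj_mul, Complex.ofReal_sum]
  exact Finset.sum_congr rfl fun x _ => by rw [Complex.ofReal_mul, ← hρ.diag_eq x]

/-- The partial transpose exchanges the B labels of row and column. It carries the mixed labels in
`swapCoeff` to the unmixed ones, and by Hermiticity both halves give the same trace. -/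
lemma sum_swapCoeff_mul_norm_sq {n m : ℕ} (i : ℤ) {σ : Op n m} (hσ : ∀ x y, star (σ x y) = σ y x) :
    ∑ x, ∑ y, swapCoeff i x y * ‖σ x y‖ ^ 2 =
      ((partialTranspose σ * sectorProj n m i * partialTranspose σ).trace).re := by
  have hn : ∀ x y, ‖σ x y‖ = ‖σ y x‖ := fun x y => by rw [← hσ, norm_star]
  have h1 : ∑ x, ∑ y, sectorInd i (y.1, x.2) * ‖σ x y‖ ^ 2 =
      ((partialTranspose σ * sectorProj n m i * partialTranspose σ).trace).re := by
    have h : ∀ x y, (partialTranspose σ * sectorProj n m i) x y * partialTranspose σ y x =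
        ((sectorInd i y * ‖partialTranspose σ x y‖ ^ 2 : ℝ) : ℂ) := fun x y => by
      have h2 : partialTranspose σ y x = star (partialTranspose σ x y) := by
        simp only [partialTranspose, Matrix.of_apply, hσ]
      rw [sectorProj_eq, Matrix.mul_diagonal, h2, Complex.star_def, mul_right_comm,
        Complex.mul_conj, Complex.normSq_eq_norm_sq, mul_comm, Complex.ofReal_mul]
    simp only [Matrix.trace, Matrix.diag_apply, Matrix.mul_apply (N := partialTranspose σ), h,
      ← Complex.ofReal_sum, Complex.ofReal_re]
    rw [← sum_two_copies fun z : AB n m × AB n m => sectorInd i (z.2.1, z.1.2) * ‖σ z.1 z.2‖ ^ 2,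
      ← sum_two_copies fun z : AB n m × AB n m => sectorInd i z.2 * ‖partialTranspose σ z.1 z.2‖ ^ 2]
    let e : AB n m × AB n m → AB n m × AB n m := fun z => ((z.1.1, z.2.2), (z.2.1, z.1.2))
    have he : Function.Involutive e := fun z => rfl
    exact Fintype.sum_equiv he.toPerm _ _ fun z => rfl
  have h2 : ∑ x, ∑ y, sectorInd i (x.1, y.2) * ‖σ x y‖ ^ 2 =
      ∑ x, ∑ y, sectorInd i (y.1, x.2) * ‖σ x y‖ ^ 2 := by
    rw [Finset.sum_comm]
    exact Finset.sum_congr rfl fun x _ => Finset.sum_congr rfl fun y _ => by rw [hn]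
  have h3 : ∀ x y, swapCoeff i x y * ‖σ x y‖ ^ 2 = 1 / 2 * (sectorInd i (y.1, x.2) * ‖σ x y‖ ^ 2) +
      1 / 2 * (sectorInd i (x.1, y.2) * ‖σ x y‖ ^ 2) := fun x y => by rw [swapCoeff]; ring
  simp only [h3, Finset.sum_add_distrib, ← Finset.mul_sum, h2, h1]
  ring

/-- The right-hand side is D/4 times the quantity maximized in `C1`. Diagonal entries are computed
exactly and produce the term -2 tr(P_i τ)². -/
lemma sum_norm_reducedObs_sq_le {n m : ℕ} (i : ℤ) {τ : Op n m} (hτ : IsState τ) :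
    ∑ x, ∑ y, ‖reducedObs i τ x y‖ ^ 2 ≤
      sectorDim n m i * ((sectorProj n m i * τ).trace).re ^ 2 +
      (((partialTranspose τ * sectorProj n m i * partialTranspose τ).trace).re -
        2 * ((sectorProj n m i * τ).trace).re ^ 2) := by
  have ht := hτ.trace_sectorProj_mul_eq i
  set t : ℝ := ∑ x, sectorInd i x * (τ x x).re with ht'
  have hbound : ∀ x y, ‖reducedObs i τ x y‖ ^ 2 ≤
      (if x = y then t ^ 2 * sectorInd i x - 2 * t * (sectorInd i x * (τ x x).re) else 0) +
        swapCoeff i x y * ‖τ x y‖ ^ 2 := fun x y => by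
    have h0 := swapCoeff_nonneg i x y
    have h1 := swapCoeff_le_one i x y
    by_cases hxy : x = y
    · subst hxy
      have hr : reducedObs i τ x x = ((t * sectorInd i x - sectorInd i x * (τ x x).re : ℝ) : ℂ) := by
        rw [reducedObs, if_pos rfl, ht, swapCoeff_self, hτ.diag_eq x]
        push_cast
        rw [Complex.ofReal_re]
      rw [hr, if_pos rfl, Complex.norm_real, Real.norm_eq_abs, sq_abs, swapCoeff_self, hτ.diag_eq x,
        Complex.norm_real, Real.norm_eq_abs, sq_abs, Complex.ofReal_re]
      refine le_of_eq ?_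
      linear_combination (t - (τ x x).re) ^ 2 * sectorInd_mul_self i x
    · rw [reducedObs, if_neg hxy, if_neg hxy, zero_sub, norm_neg, zero_add, norm_mul,
        Complex.norm_real, Real.norm_of_nonneg h0, mul_pow]
      -- The coefficient lies in [0, 1]; this is the only loss.
      have : swapCoeff i x y ^ 2 ≤ swapCoeff i x y := by nlinarith
      gcongr
  calc _ ≤ ∑ x, ∑ y, _ := Finset.sum_le_sum fun x _ => Finset.sum_le_sum fun y _ => hbound x y
    _ = _ := by
      simp only [Finset.sum_add_distrib, Finset.sum_ite_eq, Finset.mem_univ, if_true,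
        Finset.sum_sub_distrib, ← Finset.mul_sum, ← sectorDim_eq,
        sum_swapCoeff_mul_norm_sq i hτ.star_apply]
      rw [← ht', ht, Complex.ofReal_re]
      ring

/-- On a difference Δ of states the form is (tr P_i Δ)² minus a weighted sum of |Δ x y|². The first
part is at most 1, as both traces lie in [0, 1]; the second lies in [0, 4], as both purities are at
most 1. -/
lemma abs_pairing_sub_self_le {n m : ℕ} (i : ℤ) {ρ τ : Op n m} (hρ : IsState ρ) (hτ : IsState τ) :
    |pairing i (ρ - τ) (ρ - τ)| ≤ 4 := by
  have hs : ∀ x y, star ((ρ - τ) x y) = (ρ - τ) y x := fun x y => by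
    rw [Matrix.sub_apply, Matrix.sub_apply, star_sub, hρ.star_apply, hτ.star_apply]
  have htr : ∀ σ : Op n m, IsState σ → 0 ≤ ∑ x, sectorInd i x * (σ x x).re ∧
      ∑ x, sectorInd i x * (σ x x).re ≤ 1 := fun σ hσ => by
    refine ⟨Finset.sum_nonneg fun x _ => mul_nonneg (sectorInd_nonneg _ _) (hσ.diag_nonneg x), ?_⟩
    rw [← hσ.sum_diag]
    exact Finset.sum_le_sum fun x _ =>
      mul_le_of_le_one_left (hσ.diag_nonneg x) (sectorInd_le_one _ _)
  have hp : pairing i (ρ - τ) (ρ - τ) =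
      (∑ x, sectorInd i x * (ρ x x).re - ∑ x, sectorInd i x * (τ x x).re) ^ 2 -
        ∑ x, ∑ y, swapCoeff i x y * ‖(ρ - τ) x y‖ ^ 2 := by
    have h1 : ∀ x y, (swapCoeff i x y : ℂ) * (ρ - τ) y x * (ρ - τ) x y =
        ((swapCoeff i x y * ‖(ρ - τ) x y‖ ^ 2 : ℝ) : ℂ) := fun x y => by
      rw [← hs x y, mul_assoc, mul_comm (star _), Complex.star_def, Complex.mul_conj,
        Complex.normSq_eq_norm_sq, Complex.ofReal_mul]
    rw [pairing_apply, trace_obsQ_mul_kronecker, ← trace_sectorProj_mul, Matrix.mul_sub,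
      Matrix.trace_sub, hρ.trace_sectorProj_mul_eq, hτ.trace_sectorProj_mul_eq]
    simp only [h1, ← Complex.ofReal_sum, ← Complex.ofReal_sub, ← Complex.ofReal_mul,
      Complex.ofReal_re]
    ring
  have hu : ∑ x, ∑ y, swapCoeff i x y * ‖(ρ - τ) x y‖ ^ 2 ≤ 4 := by
    have h2 : ∀ x y, swapCoeff i x y * ‖(ρ - τ) x y‖ ^ 2 ≤ 2 * ‖ρ x y‖ ^ 2 + 2 * ‖τ x y‖ ^ 2 :=
      fun x y => by
        have h3 := norm_sub_le (ρ x y) (τ x y)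
        have h4 := mul_le_of_le_one_left (sq_nonneg ‖(ρ - τ) x y‖) (swapCoeff_le_one i x y)
        rw [Matrix.sub_apply] at h4 ⊢
        nlinarith [norm_nonneg (ρ x y - τ x y), sq_nonneg (‖ρ x y‖ - ‖τ x y‖)]
    have h5 : ∑ x, ∑ y, swapCoeff i x y * ‖(ρ - τ) x y‖ ^ 2 ≤
        ∑ x, ∑ y, (2 * ‖ρ x y‖ ^ 2 + 2 * ‖τ x y‖ ^ 2) :=
      Finset.sum_le_sum fun x _ => Finset.sum_le_sum fun y _ => h2 x y
    simp only [Finset.sum_add_distrib, ← Finset.mul_sum] at h5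
    linarith [hρ.sum_norm_sq_le, hτ.sum_norm_sq_le]
  have hl : 0 ≤ ∑ x, ∑ y, swapCoeff i x y * ‖(ρ - τ) x y‖ ^ 2 :=
    Finset.sum_nonneg fun x _ => Finset.sum_nonneg fun y _ =>
      mul_nonneg (swapCoeff_nonneg _ _ _) (sq_nonneg _)
  obtain ⟨a1, a2⟩ := htr ρ hρ
  obtain ⟨b1, b2⟩ := htr τ hτ
  rw [hp, abs_le]
  constructor <;> nlinarith

/-! The moments of the partial transpose -/

lemma totalNumberOp_eq (n m : ℕ) :
    totalNumberOp n m = Matrix.diagonal fun x => ((weight x.1 : ℂ) + weight x.2) := by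
  rw [totalNumberOp, numberOp, numberOp, ← Matrix.diagonal_one, ← Matrix.diagonal_one,
    Matrix.diagonal_kronecker_diagonal, Matrix.diagonal_kronecker_diagonal, Matrix.diagonal_add]
  simp

lemma apply_eq_zero_of_commute {n m : ℕ} {ρ : Op n m} (h : Commute ρ (totalNumberOp n m))
    {x y : AB n m} (hxy : weight x.1 + weight x.2 ≠ weight y.1 + weight y.2) : ρ x y = 0 := by
  have h1 := congrFun (congrFun h.eq x) y
  rw [totalNumberOp_eq, Matrix.mul_diagonal, Matrix.diagonal_mul, mul_comm] at h1
  by_contra h0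
  exact hxy (by exact_mod_cast (mul_right_cancel₀ h0 h1).symm)

/-- The second moment of P_i ρ^Γ P_i carries the indicators of both labels x and y, the form only
their mean. A nonzero entry of ρ^Γ conserves the total number in ρ, which after the exchange of B
labels says that x and y have the same difference of weights. So on the support both indicators
agree. -/
lemma D2_eq_pairing {n m : ℕ} (i : ℤ) {ρ : Op n m} (hρ : IsState ρ)
    (hsymm : Commute ρ (totalNumberOp n m)) : D2 i ρ = pairing i ρ ρ := by
  have h1 : (sectorProj n m i * partialTranspose ρ * sectorProj n m i).trace =
      (sectorProj n m i * ρ).trace := by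
    rw [Matrix.trace_mul_comm, ← Matrix.mul_assoc, trace_sectorProj_mul]
    rw [sectorProj_eq, Matrix.diagonal_mul_diagonal]
    simp only [Matrix.trace, Matrix.diag_apply, Matrix.diagonal_mul, ← Complex.ofReal_mul,
      sectorInd_mul_self]
    rfl
  have h2 : ((sectorProj n m i * partialTranspose ρ * sectorProj n m i) ^ 2).trace =
      ∑ x, ∑ y, (swapCoeff i x y : ℂ) * ρ y x * ρ x y := by
    have hx : ∀ x y, (sectorProj n m i * partialTranspose ρ * sectorProj n m i) x y *
        (sectorProj n m i * partialTranspose ρ * sectorProj n m i) y x =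
        (swapCoeff i (x.1, y.2) (y.1, x.2) : ℂ) * ρ (y.1, x.2) (x.1, y.2) *
          ρ (x.1, y.2) (y.1, x.2) := fun x y => by
      simp only [sectorProj_eq, Matrix.mul_diagonal, Matrix.diagonal_mul, partialTranspose,
        Matrix.of_apply]
      by_cases hw : weight x.1 + weight y.2 = weight y.1 + weight x.2
      · have hs : (sectorInd i y : ℝ) = sectorInd i x := by
          simp only [sectorInd]
          congr 2
          omega
        have hsw : swapCoeff i (x.1, y.2) (y.1, x.2) = sectorInd i x := by
          simp only [swapCoeff, Prod.mk.eta, hs]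
          ring
        have h3 : (sectorInd i x : ℂ) * sectorInd i x = sectorInd i x := by
          exact_mod_cast sectorInd_mul_self i x
        rw [hs, hsw]
        -- For s = s² the identity s⁴ = s follows from s⁴ - s = (s² - s)(s² + s + 1).
        linear_combination (ρ (y.1, x.2) (x.1, y.2) * ρ (x.1, y.2) (y.1, x.2)) *
          ((sectorInd i x : ℂ) * sectorInd i x + sectorInd i x + 1) * h3
      · rw [apply_eq_zero_of_commute hsymm (x := (x.1, y.2)) (y := (y.1, x.2)) hw]
        ring
    rw [pow_two]
    simp only [Matrix.trace, Matrix.diag_apply]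
    rw [Finset.sum_congr rfl fun x _ => Matrix.mul_apply]
    simp only [hx]
    rw [← sum_two_copies fun z : AB n m × AB n m =>
        (swapCoeff i z.1 z.2 : ℂ) * ρ z.2 z.1 * ρ z.1 z.2,
      ← sum_two_copies fun z : AB n m × AB n m => (swapCoeff i (z.1.1, z.2.2) (z.2.1, z.1.2) : ℂ) *
        ρ (z.2.1, z.1.2) (z.1.1, z.2.2) * ρ (z.1.1, z.2.2) (z.2.1, z.1.2)]
    let e : AB n m × AB n m → AB n m × AB n m := fun z => ((z.1.1, z.2.2), (z.2.1, z.1.2))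
    have he : Function.Involutive e := fun z => rfl
    exact Fintype.sum_equiv he.toPerm _ _ fun z => rfl
  rw [D2, moment, moment, pow_one, h1, h2, pairing_apply, trace_obsQ_mul_kronecker,
    ← trace_sectorProj_mul, hρ.trace_sectorProj_mul_eq, Complex.sub_re, ← Complex.ofReal_mul,
    Complex.ofReal_re, Complex.ofReal_re]
  ring

/-! Second moments of U-statistics over finite product distributions -/

/-- The expectation of `F` when the coordinates are independent and the `k`-th one has the
probability mass function `p k`. -/
def expect {ι S : Type*} [Fintype ι] [DecidableEq ι] [Fintype S] (p : ι → S → ℝ)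
    (F : (ι → S) → ℝ) : ℝ :=
  ∑ x, (∏ k, p k (x k)) * F x

/-- The ordered pairs of distinct indices. -/
abbrev offDiagPairs (ι : Type*) [Fintype ι] [DecidableEq ι] : Finset (ι × ι) :=
  (Finset.univ : Finset (ι × ι)).filter fun q => q.1 ≠ q.2

section UStatistics

variable {ι S : Type*} [Fintype ι] [DecidableEq ι] [Fintype S] {p : ι → S → ℝ}

lemma expect_sum {κ : Type*} (s : Finset κ) (F : κ → (ι → S) → ℝ) :
    expect p (fun x => ∑ a ∈ s, F a x) = ∑ a ∈ s, expect p (F a) := by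
  simp only [expect, Finset.mul_sum]
  exact Finset.sum_comm

lemma expect_add (F G : (ι → S) → ℝ) :
    expect p (fun x => F x + G x) = expect p F + expect p G := by
  simp only [expect, mul_add, Finset.sum_add_distrib]

lemma expect_const_mul (c : ℝ) (F : (ι → S) → ℝ) :
    expect p (fun x => c * F x) = c * expect p F := by
  simp only [expect, Finset.mul_sum]
  exact Finset.sum_congr rfl fun x _ => by ring

lemma expect_mono (hp : ∀ k s, 0 ≤ p k s) {F G : (ι → S) → ℝ} (h : ∀ x, F x ≤ G x) :
    expect p F ≤ expect p G :=
  Finset.sum_le_sum fun x _ =>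
    mul_le_mul_of_nonneg_left (h x) (Finset.prod_nonneg fun k _ => hp k _)

lemma expect_const (hp : ∀ k, ∑ s, p k s = 1) (c : ℝ) : expect p (fun _ => c) = c := by
  rw [expect, ← Finset.sum_mul, ← Fintype.prod_sum]
  simp [hp]

/-- The coordinate `l` may be averaged first. -/
lemma expect_eq_expect_average (hp : ∀ k, ∑ s, p k s = 1) (l : ι) (F : (ι → S) → ℝ) :
    expect p F = expect p fun x => ∑ s, p l s * F (Function.update x l s) := by
  let e := (Equiv.funSplitAt l S).symm
  have hl : ∀ (s : S) (y : {j // j ≠ l} → S), e (s, y) l = s := fun s y => by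
    simp [e, Equiv.funSplitAt, Equiv.piSplitAt]
  have hj : ∀ (s : S) (y : {j // j ≠ l} → S) (j : {j // j ≠ l}), e (s, y) j = y j := fun s y j => by
    simp [e, Equiv.funSplitAt, Equiv.piSplitAt, j.2]
  have hu : ∀ (s t : S) (y : {j // j ≠ l} → S), Function.update (e (s, y)) l t = e (t, y) := by
    intro s t y
    funext j
    by_cases h : j = l
    · subst h; rw [Function.update_self, hl]
    · rw [Function.update_of_ne h, hj s y ⟨j, h⟩, hj t y ⟨j, h⟩]
  have hw : ∀ (s : S) (y : {j // j ≠ l} → S),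
      ∏ k, p k (e (s, y) k) = p l s * ∏ j : {j // j ≠ l}, p j (y j) := fun s y => by
    rw [Fintype.prod_eq_mul_prod_subtype_ne _ l, hl]
    simp only [hj]
  have hsum : ∀ G : (ι → S) → ℝ, expect p G = ∑ y : {j // j ≠ l} → S,
      (∏ j : {j // j ≠ l}, p j (y j)) * ∑ s, p l s * G (e (s, y)) := fun G => by
    rw [expect, ← e.sum_comp, Fintype.sum_prod_type, Finset.sum_comm]
    refine Finset.sum_congr rfl fun y _ => ?_
    rw [Finset.mul_sum]
    refine Finset.sum_congr rfl fun s _ => ?_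
    rw [hw]
    ring
  rw [hsum, hsum]
  simp only [hu, ← Finset.sum_mul, hp, one_mul]

/-- The source of all orthogonality below: a term vanishes as soon as averaging over a single
coordinate kills it. -/
lemma expect_eq_zero (hp : ∀ k, ∑ s, p k s = 1) (l : ι) {F : (ι → S) → ℝ}
    (h : ∀ x, ∑ s, p l s * F (Function.update x l s) = 0) : expect p F = 0 := by
  rw [expect_eq_expect_average hp l]
  simp only [h, expect_const hp]

lemma expect_apply (hp : ∀ k, ∑ s, p k s = 1) (j : ι) (f : S → ℝ) :
    expect p (fun x => f (x j)) = ∑ s, p j s * f s := by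
  rw [expect_eq_expect_average hp j]
  simp only [Function.update_self, expect_const hp]

lemma expect_apply₂ (hp : ∀ k, ∑ s, p k s = 1) {j k : ι} (hjk : j ≠ k) (f : S → S → ℝ) :
    expect p (fun x => f (x j) (x k)) = ∑ s, p j s * ∑ t, p k t * f s t := by
  rw [expect_eq_expect_average hp k]
  simp only [Function.update_self, Function.update_of_ne hjk]
  exact expect_apply hp j fun s => ∑ t, p k t * f s t

variable {L : ι → S → ℝ} {R : ι → ι → S → S → ℝ}

lemma expect_sum_linear_sq (hp : ∀ k, ∑ s, p k s = 1) (hL : ∀ j, ∑ s, p j s * L j s = 0) :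
    expect p (fun x => (∑ j, L j (x j)) ^ 2) = ∑ j, ∑ s, p j s * L j s ^ 2 := by
  simp only [pow_two, Finset.sum_mul_sum]
  rw [expect_sum]
  refine Finset.sum_congr rfl fun j _ => ?_
  rw [expect_sum, Finset.sum_eq_single j]
  · exact expect_apply hp j fun s => L j s * L j s
  · intro k _ hk
    refine expect_eq_zero hp k fun x => ?_
    simp only [Function.update_self, Function.update_of_ne hk.symm, mul_left_comm _ (L j _),
      ← Finset.mul_sum, hL, mul_zero]
  · simp

/-- A pair of distinct indices contains one that differs from j; averaging over that coordinate
gives 0. -/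
lemma expect_linear_mul_quadratic (hp : ∀ k, ∑ s, p k s = 1)
    (hR : ∀ j k s, ∑ t, p k t * R j k s t = 0) (hR' : ∀ j k s t, R j k s t = R k j t s) :
    expect p (fun x => (∑ j, L j (x j)) * ∑ q ∈ offDiagPairs ι, R q.1 q.2 (x q.1) (x q.2)) = 0 := by
  simp only [Finset.sum_mul_sum]
  rw [expect_sum]
  refine Finset.sum_eq_zero fun j _ => ?_
  rw [expect_sum]
  refine Finset.sum_eq_zero fun q hq => ?_
  obtain ⟨k, l⟩ := q
  have hkl : k ≠ l := (Finset.mem_filter.mp hq).2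
  by_cases hjl : j = l
  · subst hjl
    refine expect_eq_zero hp k fun x => ?_
    simp only [hR' k j, Function.update_self, Function.update_of_ne hkl.symm, mul_left_comm _ (L j _),
      ← Finset.mul_sum, hR, mul_zero]
  · refine expect_eq_zero hp l fun x => ?_
    simp only [Function.update_self, Function.update_of_ne hkl, Function.update_of_ne hjl,
      mul_left_comm _ (L j _), ← Finset.mul_sum, hR, mul_zero]

/-- Products over two pairs vanish unless the pairs agree as sets, since otherwise some index of the
first is missing from the second. The pair and its reversal contribute equally by symmetry of R,
hence the factor 2. -/
lemma expect_quadratic_sq (hp : ∀ k, ∑ s, p k s = 1)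
    (hR : ∀ j k s, ∑ t, p k t * R j k s t = 0) (hR' : ∀ j k s t, R j k s t = R k j t s) :
    expect p (fun x => (∑ q ∈ offDiagPairs ι, R q.1 q.2 (x q.1) (x q.2)) ^ 2) =
      2 * ∑ q ∈ offDiagPairs ι, ∑ s, p q.1 s * ∑ t, p q.2 t * R q.1 q.2 s t ^ 2 := by
  have avoid_snd : ∀ {j k l m : ι}, j ≠ k → k ≠ l → k ≠ m →
      expect p (fun x => R j k (x j) (x k) * R l m (x l) (x m)) = 0 := by
    intro j k l m hjk hkl hkm
    refine expect_eq_zero hp k fun x => ?_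
    simp only [Function.update_self, Function.update_of_ne hjk, Function.update_of_ne hkl.symm,
      Function.update_of_ne hkm.symm, ← mul_assoc, ← Finset.sum_mul, hR, zero_mul]
  simp only [pow_two, Finset.sum_mul_sum]
  rw [expect_sum, Finset.mul_sum]
  refine Finset.sum_congr rfl fun q hq => ?_
  obtain ⟨j, k⟩ := q
  have hjk : j ≠ k := (Finset.mem_filter.mp hq).2
  have hne : (j, k) ≠ (k, j) := fun h => hjk (congrArg Prod.fst h)
  rw [expect_sum, ← Finset.sum_subset (s₁ := {(j, k), (k, j)}), Finset.sum_pair hne]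
  · simp only [hR' k j]
    rw [expect_apply₂ hp hjk fun s t => R j k s t * R j k s t]
    ring
  · intro q hq
    simp only [Finset.mem_insert, Finset.mem_singleton] at hq
    rcases hq with rfl | rfl
    · simpa using hjk
    · simpa using hjk.symm
  · rintro ⟨l, m⟩ hlm hnot
    have hlm' : l ≠ m := (Finset.mem_filter.mp hlm).2
    simp only [Finset.mem_insert, Finset.mem_singleton, Prod.mk.injEq, not_or, not_and] at hnot
    by_cases hk : k ≠ l ∧ k ≠ m
    · exact avoid_snd hjk hk.1 hk.2
    · have hj : j ≠ l ∧ j ≠ m := by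
        by_contra hj
        grind
      simp only [hR' j k]
      exact avoid_snd hjk.symm hj.1 hj.2

lemma expect_ustat (hp : ∀ k, ∑ s, p k s = 1) (hL : ∀ j, ∑ s, p j s * L j s = 0)
    (hR : ∀ j k s, ∑ t, p k t * R j k s t = 0) :
    expect p (fun x => 2 * ∑ j, L j (x j) +
      ∑ q ∈ offDiagPairs ι, R q.1 q.2 (x q.1) (x q.2)) = 0 := by
  have h1 : expect p (fun x => ∑ j, L j (x j)) = 0 := by
    rw [expect_sum]
    exact Finset.sum_eq_zero fun j _ => by rw [expect_apply hp j (L j), hL]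
  have h2 : expect p (fun x => ∑ q ∈ offDiagPairs ι, R q.1 q.2 (x q.1) (x q.2)) = 0 := by
    rw [expect_sum]
    refine Finset.sum_eq_zero fun q hq => ?_
    rw [expect_apply₂ hp (Finset.mem_filter.mp hq).2 (R q.1 q.2)]
    simp only [hR, mul_zero, Finset.sum_const_zero]
  rw [expect_add, expect_const_mul, h1, h2, mul_zero, add_zero]

lemma expect_ustat_sq (hp : ∀ k, ∑ s, p k s = 1) (hL : ∀ j, ∑ s, p j s * L j s = 0)
    (hR : ∀ j k s, ∑ t, p k t * R j k s t = 0) (hR' : ∀ j k s t, R j k s t = R k j t s) :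
    expect p (fun x => (2 * ∑ j, L j (x j) +
      ∑ q ∈ offDiagPairs ι, R q.1 q.2 (x q.1) (x q.2)) ^ 2) =
      4 * ∑ j, ∑ s, p j s * L j s ^ 2 +
      2 * ∑ q ∈ offDiagPairs ι, ∑ s, p q.1 s * ∑ t, p q.2 t * R q.1 q.2 s t ^ 2 := by
  have h : ∀ x : ι → S, (2 * ∑ j, L j (x j) +
      ∑ q ∈ offDiagPairs ι, R q.1 q.2 (x q.1) (x q.2)) ^ 2 =
      4 * (∑ j, L j (x j)) ^ 2 +
      (4 * ((∑ j, L j (x j)) * ∑ q ∈ offDiagPairs ι, R q.1 q.2 (x q.1) (x q.2)) +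
      (∑ q ∈ offDiagPairs ι, R q.1 q.2 (x q.1) (x q.2)) ^ 2) := fun x => by ring
  simp only [h]
  rw [expect_add, expect_add, expect_const_mul, expect_const_mul, expect_sum_linear_sq hp hL,
    expect_linear_mul_quadratic hp hR hR', expect_quadratic_sq hp hR hR', mul_zero, zero_add]

/-- The variance is at most the second moment. -/
lemma sum_mul_sub_sq_le {w : S → ℝ} (hw : ∑ s, w s = 1) (f : S → ℝ) {c : ℝ}
    (hc : ∑ s, w s * f s = c) : ∑ s, w s * (f s - c) ^ 2 ≤ ∑ s, w s * f s ^ 2 := by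
  have h : ∑ s, w s * (f s - c) ^ 2 =
      ∑ s, w s * f s ^ 2 - 2 * c * ∑ s, w s * f s + c ^ 2 * ∑ s, w s := by
    rw [Finset.mul_sum, Finset.mul_sum, ← Finset.sum_sub_distrib, ← Finset.sum_add_distrib]
    exact Finset.sum_congr rfl fun s _ => by ring
  rw [h, hc, hw]
  nlinarith [sq_nonneg c]

/-- Chebyshev's inequality. -/
lemma expect_indicator_le (hp : ∀ k s, 0 ≤ p k s) {F : (ι → S) → ℝ} {ε δ : ℝ} (hε : 0 < ε)
    (h : expect p (fun x => F x ^ 2) ≤ δ * ε ^ 2) :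
    expect p (Set.indicator {x | ε < |F x|} 1) ≤ δ := by
  have h1 : expect p (Set.indicator {x | ε < |F x|} 1) ≤
      expect p (fun x => (ε ^ 2)⁻¹ * F x ^ 2) := by
    refine expect_mono hp fun x => ?_
    by_cases hx : x ∈ {x | ε < |F x|}
    · rw [Set.indicator_of_mem hx, Pi.one_apply, ← sq_abs (F x), inv_mul_eq_div,
        one_le_div (by positivity)]
      exact pow_le_pow_left₀ hε.le (le_of_lt hx) 2
    · rw [Set.indicator_of_notMem hx]
      positivity
  rw [expect_const_mul] at h1
  refine h1.trans ?_
  rw [inv_mul_le_iff₀ (by positivity), mul_comm]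
  exact h

end UStatistics

/-- The probability of an event that depends on independent discrete random variables. -/
lemma measureReal_preimage_eq_expect {ι S Ω : Type*} [Fintype ι] [DecidableEq ι] [Fintype S]
    [MeasurableSpace S] [MeasurableSingletonClass S] [MeasurableSpace Ω] {μ : Measure Ω}
    [IsProbabilityMeasure μ] {X : ι → Ω → S} (hX : ∀ k, Measurable (X k)) (hind : iIndepFun X μ)
    (B : Set (ι → S)) :
    μ.real {ω | (fun k => X k ω) ∈ B} =
      expect (fun k s => μ.real {ω | X k ω = s}) (Set.indicator B 1) := by
  classical
  have hpt : ∀ x : ι → S, μ.real ((fun ω k => X k ω) ⁻¹' {x}) = ∏ k, μ.real {ω | X k ω = x k} := by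
    intro x
    have h := hind.measure_inter_preimage_eq_mul Finset.univ (sets := fun k => {x k})
      fun k _ => measurableSet_singleton _
    have hset : (fun ω k => X k ω) ⁻¹' {x} = ⋂ k ∈ Finset.univ, X k ⁻¹' {x k} := by
      ext ω
      simp [funext_iff]
    rw [measureReal_def, hset, h, ENNReal.toReal_prod]
    rfl
  have hB : {ω | (fun k => X k ω) ∈ B} = (fun ω k => X k ω) ⁻¹' (B.toFinset : Set (ι → S)) := by
    ext ω
    simp
  rw [hB, ← sum_measureReal_preimage_singleton _ fun x _ =>
    (measurable_pi_lambda _ hX) (measurableSet_singleton x), expect]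
  simp only [hpt, Set.indicator_apply, Pi.one_apply, mul_ite, mul_one, mul_zero]
  rw [← Finset.sum_filter]
  exact Finset.sum_congr (by ext x; simp) fun _ _ => rfl

/-! The mean squared error of the estimator -/

instance : DiscreteMeasurableSpace clifford := ⟨fun _ => trivial⟩

section Estimator

variable {n m N : ℕ}

/-- The record (setting, outcome) of one round. -/
abbrev Record (n m : ℕ) : Type := Setting n m × Outcome n m

/-- The snapshot of a record. -/
def Record.snap (s : Record n m) : Op n m := snapshot s.1 s.2

lemma sum_recordProb_mul_map {ρ : Op n m} (hρ : IsState ρ) (f : Op n m →ₗ[ℝ] ℝ) :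
    ∑ s : Record n m, recordProb ρ s * f s.snap = f ρ := by
  conv_rhs => rw [← sum_recordProb_smul_snapshot hρ]
  simp [Record.snap]

lemma sum_recordProb_mul_map_sub {ρ : Op n m} (hρ : IsState ρ) (f : Op n m →ₗ[ℝ] ℝ) :
    ∑ s : Record n m, recordProb ρ s * f (s.snap - ρ) = 0 := by
  simp only [map_sub, mul_sub, Finset.sum_sub_distrib, sum_recordProb_mul_map hρ,
    ← Finset.sum_mul, sum_recordProb hρ, one_mul, sub_self]

lemma sum_recordProb_mul_map_sub_sq_le {ρ : Op n m} (hρ : IsState ρ) (f : Op n m →ₗ[ℝ] ℝ) :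
    ∑ s : Record n m, recordProb ρ s * f (s.snap - ρ) ^ 2 ≤
      ∑ s : Record n m, recordProb ρ s * f s.snap ^ 2 := by
  simp only [map_sub]
  exact sum_mul_sub_sq_le (sum_recordProb hρ) (fun s : Record n m => f s.snap)
    (sum_recordProb_mul_map hρ f)

lemma linear_term_le {ρ : Op n m} (hρ : IsState ρ) (i : ℤ) (τ : Op n m) :
    ∑ s : Record n m, recordProb ρ s * pairing i (s.snap - ρ) τ ^ 2 ≤
      2 ^ (n + m) * ∑ x, ∑ y, ‖reducedObs i τ x y‖ ^ 2 := by
  refine (sum_recordProb_mul_map_sub_sq_le hρ ((pairing i).flip τ)).trans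
    (le_trans ?_ (sum_recordProb_mul_norm_sq_le hρ (reducedObs i τ)))
  refine Finset.sum_le_sum fun s _ => mul_le_mul_of_nonneg_left ?_ (recordProb_nonneg hρ s)
  rw [← trace_obsQ_mul_eq_reducedObs, LinearMap.flip_apply, pairing_apply, ← sq_abs]
  exact pow_le_pow_left₀ (abs_nonneg _) (Complex.abs_re_le_norm _) 2

/-- Variance is at most second moment, so the centring is removed one copy at a time, which leaves
the raw two-copy second moment. -/
lemma quadratic_term_le {ρ τ : Op n m} (hρ : IsState ρ) (hτ : IsState τ) (i : ℤ) :
    ∑ s : Record n m, recordProb ρ s * ∑ t : Record n m, recordProb τ t *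
      pairing i (s.snap - ρ) (t.snap - τ) ^ 2 ≤
      2 ^ (n + m) * (2 ^ (n + m) * ∑ x, ∑ y, ‖obsQ n m i x y‖ ^ 2) := by
  calc _ ≤ ∑ s : Record n m, recordProb ρ s * ∑ t : Record n m, recordProb τ t *
        pairing i (s.snap - ρ) t.snap ^ 2 :=
        Finset.sum_le_sum fun s _ => mul_le_mul_of_nonneg_left
          (sum_recordProb_mul_map_sub_sq_le hτ (pairing i (s.snap - ρ))) (recordProb_nonneg hρ s)
    _ = ∑ t : Record n m, recordProb τ t * ∑ s : Record n m, recordProb ρ s *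
        (pairing i).flip t.snap (s.snap - ρ) ^ 2 := by
        simp only [Finset.mul_sum]
        rw [Finset.sum_comm]
        exact Finset.sum_congr rfl fun t _ => Finset.sum_congr rfl fun s _ => mul_left_comm _ _ _
    _ ≤ ∑ t : Record n m, recordProb τ t * ∑ s : Record n m, recordProb ρ s *
        (pairing i).flip t.snap s.snap ^ 2 :=
        Finset.sum_le_sum fun t _ => mul_le_mul_of_nonneg_left
          (sum_recordProb_mul_map_sub_sq_le hρ _) (recordProb_nonneg hτ t)
    _ ≤ ∑ t : Record n m, recordProb τ t * ∑ s : Record n m, recordProb ρ s *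
        ‖(obsQ n m i * (snapshot t.1 t.2 ⊗ₖ snapshot s.1 s.2)).trace‖ ^ 2 := by
        refine Finset.sum_le_sum fun t _ => mul_le_mul_of_nonneg_left
          (Finset.sum_le_sum fun s _ => mul_le_mul_of_nonneg_left ?_ (recordProb_nonneg hρ s))
          (recordProb_nonneg hτ t)
        rw [LinearMap.flip_apply, pairing_comm, pairing_apply, ← sq_abs]
        exact pow_le_pow_left₀ (abs_nonneg _) (Complex.abs_re_le_norm _) 2
    _ ≤ _ := sum_recordProb_mul_norm_sq_kronecker_le hτ hρ _

/-! ### Hoeffding decomposition, variance and bias of the estimator -/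

/-- The mean of the estimator. -/
def meanEstimate (i : ℤ) (ρ : Fin N → Op n m) : ℝ :=
  1 / ((N : ℝ) * ((N : ℝ) - 1)) * ∑ q ∈ offDiagPairs (Fin N), pairing i (ρ q.1) (ρ q.2)

lemma sum_offDiagPairs (f : Fin N → Fin N → ℝ) :
    ∑ q ∈ offDiagPairs (Fin N), f q.1 q.2 = ∑ j, ∑ k ∈ Finset.univ.erase j, f j k := by
  rw [Finset.sum_filter, Fintype.sum_prod_type]
  refine Finset.sum_congr rfl fun j _ => ?_
  rw [← Finset.sum_filter]
  exact Finset.sum_congr (by ext k; simp [eq_comm]) fun _ _ => rfl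

lemma sum_offDiagPairs_swap (f : Fin N → Fin N → ℝ) :
    ∑ q ∈ offDiagPairs (Fin N), f q.2 q.1 = ∑ q ∈ offDiagPairs (Fin N), f q.1 q.2 := by
  refine Finset.sum_equiv (Equiv.prodComm _ _) (fun q => ?_) fun q _ => rfl
  simp [eq_comm]

/-- The linear terms of the Hoeffding decomposition. -/
def linearTerm (i : ℤ) (ρ : Fin N → Op n m) (j : Fin N) (s : Record n m) : ℝ :=
  pairing i (s.snap - ρ j) (∑ k ∈ Finset.univ.erase j, ρ k)

/-- The quadratic terms of the Hoeffding decomposition. -/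
def quadraticTerm (i : ℤ) (ρ : Fin N → Op n m) (j k : Fin N) (s t : Record n m) : ℝ :=
  pairing i (s.snap - ρ j) (t.snap - ρ k)

lemma sum_recordProb_mul_linearTerm {ρ : Fin N → Op n m} (hρ : ∀ k, IsState (ρ k)) (i : ℤ)
    (j : Fin N) : ∑ s, recordProb (ρ j) s * linearTerm i ρ j s = 0 := by
  have h := sum_recordProb_mul_map_sub (hρ j)
    ((pairing i).flip (∑ k ∈ Finset.univ.erase j, ρ k))
  simp only [LinearMap.flip_apply] at h
  simp only [linearTerm]
  exact h

lemma sum_recordProb_mul_quadraticTerm {ρ : Fin N → Op n m} (hρ : ∀ k, IsState (ρ k)) (i : ℤ)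
    (j k : Fin N) (s : Record n m) :
    ∑ t, recordProb (ρ k) t * quadraticTerm i ρ j k s t = 0 :=
  sum_recordProb_mul_map_sub (hρ k) (pairing i (s.snap - ρ j))

lemma quadraticTerm_symm (i : ℤ) (ρ : Fin N → Op n m) (j k : Fin N) (s t : Record n m) :
    quadraticTerm i ρ j k s t = quadraticTerm i ρ k j t s :=
  pairing_comm _ _ _

/-- The Hoeffding decomposition of the estimator. -/
lemma estimator_sub_mean (i : ℤ) (ρ : Fin N → Op n m) (x : Fin N → Record n m) :
    estimator i (fun k => (x k).1) (fun k => (x k).2) - meanEstimate i ρ =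
      1 / ((N : ℝ) * ((N : ℝ) - 1)) *
        (2 * ∑ j, linearTerm i ρ j (x j) +
          ∑ q ∈ offDiagPairs (Fin N), quadraticTerm i ρ q.1 q.2 (x q.1) (x q.2)) := by
  have hlin : ∑ j, linearTerm i ρ j (x j) =
      ∑ q ∈ offDiagPairs (Fin N), pairing i ((x q.1).snap - ρ q.1) (ρ q.2) := by
    rw [sum_offDiagPairs fun j k => pairing i ((x j).snap - ρ j) (ρ k)]
    simp only [linearTerm, map_sum]
  have hlin' : ∑ q ∈ offDiagPairs (Fin N), pairing i (ρ q.1) ((x q.2).snap - ρ q.2) =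
      ∑ q ∈ offDiagPairs (Fin N), pairing i ((x q.1).snap - ρ q.1) (ρ q.2) := by
    rw [← sum_offDiagPairs_swap fun j k => pairing i ((x j).snap - ρ j) (ρ k)]
    exact Finset.sum_congr rfl fun q _ => pairing_comm _ _ _
  rw [estimator, meanEstimate, ← mul_sub, ← Finset.sum_sub_distrib, two_mul, hlin]
  -- Expanding the form gives one linear sum in each slot; they are equal by symmetry, so one of the
  -- two copies is moved to the second slot.
  nth_rewrite 1 [← hlin']
  rw [← Finset.sum_add_distrib, ← Finset.sum_add_distrib]
  congr 1
  refine Finset.sum_congr rfl fun q _ => ?_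
  have : ((obsQ n m i * (snapshot (x q.1).1 (x q.1).2 ⊗ₖ snapshot (x q.2).1 (x q.2).2)).trace).re =
      pairing i (x q.1).snap (x q.2).snap := rfl
  rw [this]
  simp only [quadraticTerm, map_sub, LinearMap.sub_apply]
  ring

lemma expect_estimator_sub_mean {ρ : Fin N → Op n m} (hρ : ∀ k, IsState (ρ k)) (i : ℤ) :
    expect (fun k => recordProb (ρ k)) (fun x =>
      estimator i (fun k => (x k).1) (fun k => (x k).2) - meanEstimate i ρ) = 0 := by
  simp only [estimator_sub_mean]
  rw [expect_const_mul, expect_ustat (fun k => sum_recordProb (hρ k))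
    (sum_recordProb_mul_linearTerm hρ i) (sum_recordProb_mul_quadraticTerm hρ i), mul_zero]

lemma expect_estimator_sub_mean_sq_le (hN : 2 ≤ N) {ρ : Fin N → Op n m} (hρ : ∀ k, IsState (ρ k))
    (i : ℤ) {c : ℝ} (hc : ∀ k, ∑ x, ∑ y, ‖reducedObs i (ρ k) x y‖ ^ 2 ≤ c) :
    expect (fun k => recordProb (ρ k)) (fun x =>
      (estimator i (fun k => (x k).1) (fun k => (x k).2) - meanEstimate i ρ) ^ 2) ≤
      4 * 2 ^ (n + m) * c / N + 2 * (2 ^ (n + m) * (2 ^ (n + m) *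
        ∑ x, ∑ y, ‖obsQ n m i x y‖ ^ 2)) / (N * (N - 1)) := by
  have hN' : (2 : ℝ) ≤ N := by exact_mod_cast hN
  simp only [estimator_sub_mean, mul_pow]
  rw [expect_const_mul, expect_ustat_sq (fun k => sum_recordProb (hρ k))
    (sum_recordProb_mul_linearTerm hρ i) (sum_recordProb_mul_quadraticTerm hρ i)
    (quadraticTerm_symm i ρ)]
  set K := 2 ^ (n + m) * (2 ^ (n + m) * ∑ x, ∑ y, ‖obsQ n m i x y‖ ^ 2)
  -- The factor (N-1)² comes from the N-1 states in the second slot; with the N rounds and the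
  -- prefactor squared it leaves 1/N.
  have h1 : ∑ j, ∑ s, recordProb (ρ j) s * linearTerm i ρ j s ^ 2 ≤
      N * (2 ^ (n + m) * (((N : ℝ) - 1) ^ 2 * c)) := by
    have : ∀ j : Fin N, ∑ s, recordProb (ρ j) s * linearTerm i ρ j s ^ 2 ≤
        2 ^ (n + m) * (((N : ℝ) - 1) ^ 2 * c) := fun j => by
      refine (linear_term_le (hρ j) i _).trans ?_
      have h := sum_norm_reducedObs_sum_le i (Finset.univ.erase j) ρ fun k _ => hc k
      rw [Finset.card_erase_of_mem (Finset.mem_univ j), Finset.card_univ, Fintype.card_fin,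
        Nat.cast_sub (by omega), Nat.cast_one] at h
      gcongr
    calc _ ≤ ∑ _j : Fin N, 2 ^ (n + m) * (((N : ℝ) - 1) ^ 2 * c) :=
          Finset.sum_le_sum fun j _ => this j
      _ = _ := by simp
  have h2 : ∑ q ∈ offDiagPairs (Fin N), ∑ s, recordProb (ρ q.1) s *
      ∑ t, recordProb (ρ q.2) t * quadraticTerm i ρ q.1 q.2 s t ^ 2 ≤ N * ((N : ℝ) - 1) * K := by
    have hcard : ∑ _q ∈ offDiagPairs (Fin N), K = N * ((N : ℝ) - 1) * K := by
      rw [sum_offDiagPairs fun _ _ => K]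
      simp only [Finset.sum_const, Finset.card_erase_of_mem (Finset.mem_univ _), Finset.card_univ,
        Fintype.card_fin, nsmul_eq_mul, Nat.cast_sub (show 1 ≤ N by omega), Nat.cast_one]
      ring
    rw [← hcard]
    exact Finset.sum_le_sum fun q _ => quadratic_term_le (hρ q.1) (hρ q.2) i
  have h3 : (0 : ℝ) < N - 1 := by linarith
  calc _ ≤ (1 / ((N : ℝ) * ((N : ℝ) - 1))) ^ 2 *
        (4 * (N * (2 ^ (n + m) * (((N : ℝ) - 1) ^ 2 * c))) + 2 * (N * ((N : ℝ) - 1) * K)) := by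
        gcongr
    _ = _ := by field_simp

/-- The estimator is biased when the states are not identical, but only by `O(1 / N)`. -/
lemma abs_mean_sub_pairing_avg_le (hN : 2 ≤ N) {ρ : Fin N → Op n m} (hρ : ∀ k, IsState (ρ k))
    (i : ℤ) :
    |meanEstimate i ρ - pairing i (avgState ρ) (avgState ρ)| ≤ 2 / ((N : ℝ) - 1) := by
  have hN' : (2 : ℝ) ≤ N := by exact_mod_cast hN
  have h3 : (0 : ℝ) < N - 1 := by linarith
  set T := ∑ j, ∑ k, pairing i (ρ j) (ρ k) with hT
  set G := ∑ j, pairing i (ρ j) (ρ j) with hG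
  have havg : avgState ρ = (N : ℝ)⁻¹ • ∑ k, ρ k := by
    rw [avgState, ← Complex.coe_smul]
    push_cast
    rfl
  have h1 : pairing i (avgState ρ) (avgState ρ) = (N : ℝ)⁻¹ * ((N : ℝ)⁻¹ * T) := by
    rw [havg]
    simp only [map_smul, LinearMap.smul_apply, map_sum, LinearMap.sum_apply, smul_eq_mul, hT]
    rw [← Finset.mul_sum, Finset.sum_comm]
  have h2 : ∑ q ∈ offDiagPairs (Fin N), pairing i (ρ q.1) (ρ q.2) = T - G := by
    rw [sum_offDiagPairs fun j k => pairing i (ρ j) (ρ k), hT, hG, ← Finset.sum_sub_distrib]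
    refine Finset.sum_congr rfl fun j _ => ?_
    rw [← Finset.sum_erase_add _ _ (Finset.mem_univ j), add_sub_cancel_right]
  -- The bias is a multiple of the total dispersion of the states, so it is bounded by the form on
  -- differences of states.
  have h4 : ∑ j, ∑ k, pairing i (ρ j - ρ k) (ρ j - ρ k) = 2 * (N * G - T) := by
    have h5 : ∀ j k, pairing i (ρ j - ρ k) (ρ j - ρ k) =
        pairing i (ρ j) (ρ j) + pairing i (ρ k) (ρ k) - 2 * pairing i (ρ j) (ρ k) := fun j k => by
      simp only [map_sub, LinearMap.sub_apply]
      rw [pairing_comm i (ρ k) (ρ j)]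
      ring
    simp only [h5, Finset.sum_sub_distrib, Finset.sum_add_distrib, ← Finset.mul_sum, Finset.sum_const,
      Finset.card_univ, Fintype.card_fin, nsmul_eq_mul, ← hG, ← hT]
    ring
  have h6 : |∑ j, ∑ k, pairing i (ρ j - ρ k) (ρ j - ρ k)| ≤ N * (N * 4) := by
    calc _ ≤ ∑ _j : Fin N, ∑ _k : Fin N, (4 : ℝ) :=
          (Finset.abs_sum_le_sum_abs _ _).trans (Finset.sum_le_sum fun j _ =>
            (Finset.abs_sum_le_sum_abs _ _).trans (Finset.sum_le_sum fun k _ =>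
              abs_pairing_sub_self_le i (hρ j) (hρ k)))
      _ = _ := by simp
  have h7 : meanEstimate i ρ - pairing i (avgState ρ) (avgState ρ) =
      -(∑ j, ∑ k, pairing i (ρ j - ρ k) (ρ j - ρ k)) * (1 / (2 * N ^ 2 * ((N : ℝ) - 1))) := by
    rw [meanEstimate, h1, h2, h4]
    field_simp
    ring
  rw [h7, abs_mul, abs_neg, abs_of_nonneg
    (by positivity : 0 ≤ 1 / (2 * (N : ℝ) ^ 2 * ((N : ℝ) - 1)))]
  calc _ ≤ N * (N * 4) * (1 / (2 * (N : ℝ) ^ 2 * ((N : ℝ) - 1))) := by gcongr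
    _ = _ := by field_simp; norm_num

lemma avgState_isState (hN : 2 ≤ N) {ρ : Fin N → Op n m} (hρ : ∀ k, IsState (ρ k)) :
    IsState (avgState ρ) := by
  have h0 : (N : ℂ) ≠ 0 := by
    exact_mod_cast (by omega : N ≠ 0)
  refine ⟨(Matrix.posSemidef_sum _ fun k _ => (hρ k).1).smul ?_, ?_⟩
  · rw [← Complex.ofReal_natCast, ← Complex.ofReal_inv]
    exact Complex.zero_le_real.mpr (by positivity)
  · rw [avgState, Matrix.trace_smul, Matrix.trace_sum, Finset.sum_congr rfl fun k _ => (hρ k).2]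
    simp [h0]

lemma avgState_commute {ρ : Fin N → Op n m} (h : ∀ k, Commute (ρ k) (totalNumberOp n m)) :
    Commute (avgState ρ) (totalNumberOp n m) :=
  (Commute.sum_left _ _ _ fun k _ => h k).smul_left _

lemma sum_norm_reducedObs_sq_le_C1 {i : ℤ} (hD : 1 ≤ sectorDim n m i) {ρ : Fin N → Op n m}
    (hρ : ∀ k, IsState (ρ k)) (k : Fin N) :
    ∑ x, ∑ y, ‖reducedObs i (ρ k) x y‖ ^ 2 ≤ sectorDim n m i * C1 i ρ / 4 := by
  have h := le_ciSup (Set.finite_range fun k : Fin N => 4 * (((sectorProj n m i * ρ k).trace).re ^ 2 +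
    (((partialTranspose (ρ k) * sectorProj n m i * partialTranspose (ρ k)).trace).re -
      2 * ((sectorProj n m i * ρ k).trace).re ^ 2) / sectorDim n m i)).bddAbove k
  refine (sum_norm_reducedObs_sq_le i (hρ k)).trans ?_
  have hD0 : 0 < sectorDim n m i := by linarith
  calc _ = sectorDim n m i * (4 * (((sectorProj n m i * ρ k).trace).re ^ 2 +
      (((partialTranspose (ρ k) * sectorProj n m i * partialTranspose (ρ k)).trace).re -
      2 * ((sectorProj n m i * ρ k).trace).re ^ 2) / sectorDim n m i)) / 4 := by
        field_simp
    _ ≤ _ := by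
        gcongr
        exact h

lemma C1_nonneg (hN : 0 < N) {i : ℤ} (hD : 1 ≤ sectorDim n m i) {ρ : Fin N → Op n m}
    (hρ : ∀ k, IsState (ρ k)) : 0 ≤ C1 i ρ := by
  have h0 : 0 ≤ sectorDim n m i * C1 i ρ / 4 :=
    le_trans (Finset.sum_nonneg fun x _ => Finset.sum_nonneg fun y _ => sq_nonneg _)
      (sum_norm_reducedObs_sq_le_C1 hD hρ ⟨0, hN⟩)
  exact nonneg_of_mul_nonneg_right (a := sectorDim n m i) (by linarith) (by linarith)

/-! ### Mean squared error and half-width -/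

/-- The squared half-width splits into the linear, the quadratic and the bias contribution. -/
lemma error_budget_eq (hN : 2 ≤ N) {i : ℤ} (hD : 1 ≤ sectorDim n m i) {ρ : Fin N → Op n m} :
    2 ^ (n + m) * sectorDim n m i / ((N : ℝ) - 1) *
        (C1 i ρ + C2 n m i * (2 ^ (2 * (n + m)) / ((N : ℝ) - 1))) =
      2 ^ (n + m) * sectorDim n m i * C1 i ρ / (N - 1) +
        2 * (2 ^ (n + m) * (2 ^ (n + m) * ∑ x, ∑ y, ‖obsQ n m i x y‖ ^ 2)) /
          ((N - 1) * (N - 1)) + 8 / ((N : ℝ) - 1) ^ 2 := by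
  have hN' : (2 : ℝ) ≤ N := by exact_mod_cast hN
  have h3 : (0 : ℝ) < N - 1 := by linarith
  have hpow : (2 : ℝ) ^ (2 * (n + m)) = (2 ^ (n + m)) ^ 2 := by rw [mul_comm, pow_mul]
  have hd : (0 : ℝ) < 2 ^ (n + m) := by positivity
  rw [C2, hpow, sum_norm_obsQ_sq]
  generalize (2 : ℝ) ^ (n + m) = d at *
  generalize sectorDim n m i = D at *
  have hD0 : 0 < D := by linarith
  field_simp
  ring

/-- The mean squared error of the estimator. -/
lemma expect_estimator_sub_D2_sq_le (hN : 2 ≤ N) {i : ℤ} (hD : 1 ≤ sectorDim n m i)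
    {ρ : Fin N → Op n m} (hρ : ∀ k, IsState (ρ k))
    (hsymm : ∀ k, Commute (ρ k) (totalNumberOp n m)) :
    expect (fun k => recordProb (ρ k)) (fun x =>
      (estimator i (fun k => (x k).1) (fun k => (x k).2) - D2 i (avgState ρ)) ^ 2) ≤
      2 ^ (n + m) * sectorDim n m i / ((N : ℝ) - 1) *
        (C1 i ρ + C2 n m i * (2 ^ (2 * (n + m)) / ((N : ℝ) - 1))) := by
  have hN' : (2 : ℝ) ≤ N := by exact_mod_cast hN
  have h3 : (0 : ℝ) < N - 1 := by linarith
  have hp := fun k => sum_recordProb (hρ k)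
  rw [D2_eq_pairing i (avgState_isState hN hρ) (avgState_commute hsymm)]
  set a := meanEstimate i ρ - pairing i (avgState ρ) (avgState ρ) with ha
  have hsplit : ∀ x : Fin N → Record n m, (estimator i (fun k => (x k).1) (fun k => (x k).2) -
      pairing i (avgState ρ) (avgState ρ)) ^ 2 =
      (estimator i (fun k => (x k).1) (fun k => (x k).2) - meanEstimate i ρ) ^ 2 +
      (2 * a * (estimator i (fun k => (x k).1) (fun k => (x k).2) - meanEstimate i ρ) + a ^ 2) :=
    fun x => by rw [ha]; ring
  simp only [hsplit]
  rw [expect_add, expect_add, expect_const_mul, expect_estimator_sub_mean hρ, mul_zero, zero_add,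
    expect_const hp]
  have hv := expect_estimator_sub_mean_sq_le hN hρ i (sum_norm_reducedObs_sq_le_C1 hD hρ)
  have hb : a ^ 2 ≤ (2 / ((N : ℝ) - 1)) ^ 2 := by
    rw [← sq_abs a]
    exact pow_le_pow_left₀ (abs_nonneg _) (abs_mean_sub_pairing_avg_le hN hρ i) 2
  have hC1 := C1_nonneg (by omega) hD hρ
  have hQ : 0 ≤ ∑ x, ∑ y, ‖obsQ n m i x y‖ ^ 2 :=
    Finset.sum_nonneg fun x _ => Finset.sum_nonneg fun y _ => sq_nonneg _
  have hD0 : 0 < sectorDim n m i := by linarith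
  -- The half-width has N - 1 where the variance has N.
  have e1 : 4 * 2 ^ (n + m) * (sectorDim n m i * C1 i ρ / 4) / N ≤
      2 ^ (n + m) * sectorDim n m i * C1 i ρ / (N - 1) := by
    rw [show 4 * 2 ^ (n + m) * (sectorDim n m i * C1 i ρ / 4) =
      2 ^ (n + m) * sectorDim n m i * C1 i ρ by ring]
    gcongr
    linarith
  have e2 : 2 * (2 ^ (n + m) * (2 ^ (n + m) * ∑ x, ∑ y, ‖obsQ n m i x y‖ ^ 2)) / (N * (N - 1)) ≤
      2 * (2 ^ (n + m) * (2 ^ (n + m) * ∑ x, ∑ y, ‖obsQ n m i x y‖ ^ 2)) /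
        (((N : ℝ) - 1) * (N - 1)) := by
    gcongr
    linarith
  have e4 : (2 / ((N : ℝ) - 1)) ^ 2 ≤ 8 / ((N : ℝ) - 1) ^ 2 := by
    rw [div_pow]
    gcongr
    norm_num
  rw [error_budget_eq hN hD]
  linarith

lemma halfWidth_sq_pos (hN : 2 ≤ N) {i : ℤ} (hD : 1 ≤ sectorDim n m i)
    {ρ : Fin N → Op n m} (hρ : ∀ k, IsState (ρ k)) {δ : ℝ} (hδ : 0 < δ) :
    0 < halfWidth i δ ρ ∧ δ * halfWidth i δ ρ ^ 2 =
      2 ^ (n + m) * sectorDim n m i / ((N : ℝ) - 1) *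
        (C1 i ρ + C2 n m i * (2 ^ (2 * (n + m)) / ((N : ℝ) - 1))) := by
  have hN' : (2 : ℝ) ≤ N := by exact_mod_cast hN
  have h3 : (0 : ℝ) < N - 1 := by linarith
  have hpos : 0 < 2 ^ (n + m) * sectorDim n m i / ((N : ℝ) - 1) *
      (C1 i ρ + C2 n m i * (2 ^ (2 * (n + m)) / ((N : ℝ) - 1))) := by
    have hC1 := C1_nonneg (by omega) hD hρ
    have hQ : 0 ≤ ∑ x, ∑ y, ‖obsQ n m i x y‖ ^ 2 :=
      Finset.sum_nonneg fun x _ => Finset.sum_nonneg fun y _ => sq_nonneg _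
    have hD0 : 0 < sectorDim n m i := by linarith
    rw [error_budget_eq hN hD]
    -- The linear and quadratic parts are only known to be nonnegative; strictness comes from the
    -- bias allowance 8/(N-1)². It is needed because Chebyshev's inequality divides by the squared
    -- half-width.
    positivity
  have hw : 2 ^ (n + m) * sectorDim n m i / (δ * ((N : ℝ) - 1)) *
      (C1 i ρ + C2 n m i * (2 ^ (2 * (n + m)) / ((N : ℝ) - 1))) =
      2 ^ (n + m) * sectorDim n m i / ((N : ℝ) - 1) *
      (C1 i ρ + C2 n m i * (2 ^ (2 * (n + m)) / ((N : ℝ) - 1))) / δ := by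
    field_simp
  rw [halfWidth, hw]
  refine ⟨Real.sqrt_pos.mpr (div_pos hpos hδ), ?_⟩
  rw [Real.sq_sqrt (div_pos hpos hδ).le, mul_div_cancel₀ _ hδ.ne']

/-- The records of the rounds are distributed according to `recordProb`. -/
lemma measureReal_mem_eq_expect {Ω : Type*} [MeasurableSpace Ω] {μ : Measure Ω}
    [IsProbabilityMeasure μ] {ρ : Fin N → Op n m} {U : Fin N → Ω → Setting n m}
    {b : Fin N → Ω → Outcome n m} (h : IsRandomizedMeasurement μ ρ U b)
    (B : Set (Fin N → Record n m)) :
    μ.real {ω | (fun k => (U k ω, b k ω)) ∈ B} =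
      expect (fun k => recordProb (ρ k)) (Set.indicator B 1) := by
  rw [measureReal_preimage_eq_expect
    (fun k => (h.measurable_setting k).prodMk (h.measurable_outcome k)) h.indep B]
  congr 1
  funext k s
  rw [recordProb, ← h.law]
  simp only [Prod.ext_iff]

end Estimator

end

end SymShadow

/-! ### The confidence interval -/

theorem mainTheorem5 {n m N : ℕ} (hN : 2 ≤ N) (i : ℤ) (hi : -(m : ℤ) ≤ i ∧ i ≤ (n : ℤ))
    (δ : ℝ) (hδ : 0 < δ ∧ δ < 1)
    (ρ : Fin N → SymShadow.Op n m) (hρ : ∀ k, SymShadow.IsState (ρ k))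
    (hsymm : ∀ k, Commute (ρ k) (SymShadow.totalNumberOp n m))
    {Ω : Type*} [MeasurableSpace Ω] (μ : MeasureTheory.Measure Ω)
    [MeasureTheory.IsProbabilityMeasure μ]
    (U : Fin N → Ω → SymShadow.Setting n m) (b : Fin N → Ω → SymShadow.Outcome n m)
    (hUb : SymShadow.IsRandomizedMeasurement μ ρ U b) :
    1 - δ ≤ μ.real {ω | SymShadow.D2 i (SymShadow.avgState ρ) ∈ Set.Icc
      (SymShadow.estimator i (fun k => U k ω) (fun k => b k ω) - SymShadow.halfWidth i δ ρ)
      (SymShadow.estimator i (fun k => U k ω) (fun k => b k ω) + SymShadow.halfWidth i δ ρ)} := by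
  have hD := SymShadow.one_le_sectorDim hi
  obtain ⟨hw, hw2⟩ := SymShadow.halfWidth_sq_pos hN hD hρ hδ.1
  have hmse := SymShadow.expect_estimator_sub_D2_sq_le hN hD hρ hsymm
  -- The half-width ε is chosen so that the bound on the mean squared error is exactly δ ε², as
  -- Chebyshev's inequality requires.
  rw [← hw2] at hmse
  have hcheb := SymShadow.expect_indicator_le (fun k s => SymShadow.recordProb_nonneg (hρ k) s)
    hw hmse
  set F : (Fin N → SymShadow.Record n m) → ℝ := fun x =>
    SymShadow.estimator i (fun k => (x k).1) (fun k => (x k).2) -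
      SymShadow.D2 i (SymShadow.avgState ρ) with hF
  have hset : {ω | SymShadow.D2 i (SymShadow.avgState ρ) ∈ Set.Icc
      (SymShadow.estimator i (fun k => U k ω) (fun k => b k ω) - SymShadow.halfWidth i δ ρ)
      (SymShadow.estimator i (fun k => U k ω) (fun k => b k ω) + SymShadow.halfWidth i δ ρ)} =
      {ω | (fun k => (U k ω, b k ω)) ∈ {x | SymShadow.halfWidth i δ ρ < |F x|}ᶜ} := by
    ext ω
    simp only [Set.mem_ofPred_eq, Set.mem_Icc, Set.mem_compl_iff, not_lt, hF, abs_le]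
    constructor <;> rintro ⟨h1, h2⟩ <;> constructor <;> linarith
  rw [hset, SymShadow.measureReal_mem_eq_expect hUb]
  -- The failure event and its complement have total probability 1, so the bound δ on the first
  -- gives 1 - δ for the second.
  have htot := SymShadow.expect_add (p := fun k => SymShadow.recordProb (ρ k))
    (Set.indicator {x | SymShadow.halfWidth i δ ρ < |F x|} 1)
    (Set.indicator {x | SymShadow.halfWidth i δ ρ < |F x|}ᶜ 1)
  have hone : (fun x => Set.indicator {x | SymShadow.halfWidth i δ ρ < |F x|}
      (1 : (Fin N → SymShadow.Record n m) → ℝ) x +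
      Set.indicator {x | SymShadow.halfWidth i δ ρ < |F x|}ᶜ 1 x) = fun _ => 1 := by
    funext x
    exact congrFun (Set.indicator_self_add_compl _ _) x
  rw [hone, SymShadow.expect_const fun k => SymShadow.sum_recordProb (hρ k)] at htot
  linarith
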